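/- Let $a(n,t)>0$ and $b(n,t)$, $n\in\mathbb{Z}$, be real and such that, at the time $t$ considered, $\sum_{n}|n|^l\big(|a(n,t)-\tfrac12|+|b(n,t)|\big)<\infty$ for every $l\in\mathbb{N}$ (for instance a decaying solution of the Toda lattice). For $0<|z|\le 1$ let $\psi_\pm(z,\cdot,t)$ be the Jost functions, i.e. the unique solutions of $$a(n,t)\psi(n+1)+a(n-1,t)\psi(n-1)+b(n,t)\psi(n)=\tfrac12(z+z^{-1})\,\psi(n),\qquad n\in\mathbb{Z},$$ with $\lim_{n\to\pm\infty}z^{\mp n}\psi_\pm(z,n,t)=1$. Let $T(z)$ be the transmission coefficient, i.e. the meromorphic function in the unit disc whose boundary values satisfy $T\psi_\mp=\overline{\psi_\pm}+R_\pm\psi_\pm$ for $|z|=1$, with coefficients $R_\pm(z,t)$ independent of $n$; explicitly $T(z)=\dfrac{z^{-1}-z}{2W(z)}$ with $W(z)=a(n,t)\big(\psi_+(z,n,t)\psi_-(z,n+1,t)-\psi_+(z,n+1,t)\psi_-(z,n,t)\big)$, which does not depend on $n$. For $n\in\mathbb{Z}$ put $$m(z,n,t)=\begin{cases}\begin{pmatrix}T(z)\psi_-(z,n,t)z^n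 & \psi_+(z,n,t)z^{-n}\end{pmatrix}, & |z|<1,\\[2pt] \begin{pmatrix}\psi_+(z^{-1},n,t)z^n & T(z^{-1})\psi_-(z^{-1},n,t)z^{-n}\end{pmatrix}, & |z|>1,\end{cases}$$ where values at removable singularities are limits, and values at $|z|=1$ are the boundary values from $|z|<1$ or from $|z|>1$. If $m(z_1,n,t)=\begin{pmatrix}0&0\end{pmatrix}$ for some $z_1\in\mathbb{C}$ (for $|z_1|=1$: from at least one of the two sides), then $z_1=\pm1$. Moreover, in this case at least one component $m_j$ has a simple zero at $z_1$: for each of the two regions $|z|<1$ and $|z|>1$, the limit of $m_j(z,n,t)/(z-z_1)$ as $z\to z_1$ within the region exists, is finite and is nonzero. -/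

import Mathlib

open Filter Topology

/-! Scattering theory of a Jacobi operator
`(H f)(n) = a(n) f(n+1) + a(n-1) f(n-1) + b(n) f(n)` on `ℤ`, with `a, b` real,
in the variable `z`, where the spectral parameter is `λ = (z + z⁻¹) / 2`. -/

/-- `a > 0` and `∑ₙ |n|^l (|a(n) - 1/2| + |b(n)|) < ∞` for every `l`. -/
structure JacobiDecay (a b : ℤ → ℝ) : Prop where
  pos : ∀ n, 0 < a n
  summable : ∀ l : ℕ, Summable fun n : ℤ => |(n : ℝ)| ^ l * (|a n - 1 / 2| + |b n|)

/-- The Jacobi difference expression. -/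
def jacobiOp (a b : ℤ → ℝ) (f : ℤ → ℂ) (n : ℤ) : ℂ :=
  a n * f (n + 1) + a (n - 1) * f (n - 1) + b n * f n

/-- `u` solves `H u = ((z + z⁻¹) / 2) u`. -/
def IsJacobiSolution (a b : ℤ → ℝ) (z : ℂ) (u : ℤ → ℂ) : Prop :=
  ∀ n, jacobiOp a b u n = (z + z⁻¹) / 2 * u n

/-- `u` is the solution with `z^{-n} u(n) → 1` as `n → +∞`. -/
def IsJostPlus (a b : ℤ → ℝ) (z : ℂ) (u : ℤ → ℂ) : Prop :=
  IsJacobiSolution a b z u ∧ Tendsto (fun n : ℤ => z ^ (-n) * u n) atTop (𝓝 1)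

/-- `u` is the solution with `z^{n} u(n) → 1` as `n → -∞`. -/
def IsJostMinus (a b : ℤ → ℝ) (z : ℂ) (u : ℤ → ℂ) : Prop :=
  IsJacobiSolution a b z u ∧ Tendsto (fun n : ℤ => z ^ n * u n) atBot (𝓝 1)

/-- The Jost function `ψ₊(z, ·)`, meaningful for `0 < |z| ≤ 1`,
where there is exactly one such solution. -/
noncomputable def jostPlus (a b : ℤ → ℝ) (z : ℂ) : ℤ → ℂ :=
  Classical.epsilon (IsJostPlus a b z)

/-- The Jost function `ψ₋(z, ·)`, meaningful for `0 < |z| ≤ 1`,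
where there is exactly one such solution. -/
noncomputable def jostMinus (a b : ℤ → ℝ) (z : ℂ) : ℤ → ℂ :=
  Classical.epsilon (IsJostMinus a b z)

/-- The modified Wronskian `a(n) (u(n) v(n+1) - u(n+1) v(n))`. -/
def jacobiWronskian (a : ℤ → ℝ) (u v : ℤ → ℂ) (n : ℤ) : ℂ :=
  a n * (u n * v (n + 1) - u (n + 1) * v n)

/-- The Wronskian of two solutions does not depend on `n`. -/
theorem jacobiWronskian_eq {a b : ℤ → ℝ} {z : ℂ} {u v : ℤ → ℂ}
    (hu : IsJacobiSolution a b z u) (hv : IsJacobiSolution a b z v) (n : ℤ) :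
    jacobiWronskian a u v n = jacobiWronskian a u v 0 := by
  have step : ∀ m : ℤ, jacobiWronskian a u v (m + 1) = jacobiWronskian a u v m := by
    intro m
    have h1 := hu (m + 1)
    have h2 := hv (m + 1)
    simp only [jacobiOp, add_sub_cancel_right] at h1 h2
    simp only [jacobiWronskian]
    linear_combination u (m + 1) * h2 - v (m + 1) * h1
  induction n using Int.induction_on with
  | zero => rfl
  | succ k ih => rw [step, ih]
  | pred k ih => rw [← ih, ← step (-(k : ℤ) - 1), sub_add_cancel]

/-- The transmission coefficient
`T(z) = (z⁻¹ - z) / (2 W(ψ₊(z), ψ₋(z)))`, for `0 < |z| ≤ 1`. That it is the `T` of the scattering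
relations on the unit circle is `scattering_relations` below; the formula is also its meromorphic
extension to the disc. At a zero of `W` (a pole of `T`) the value `0` is a mere convention, so
`T` is only ever used through limits. -/
noncomputable def transmission (a b : ℤ → ℝ) (z : ℂ) : ℂ :=
  (z⁻¹ - z) / (2 * jacobiWronskian a (jostPlus a b z) (jostMinus a b z) 0)

/-- The row vector `m(z, n)`, for `|z| ≠ 1`, `z ≠ 0`. -/
noncomputable def jostVector (a b : ℤ → ℝ) (n : ℤ) (z : ℂ) : Fin 2 → ℂ :=
  if ‖z‖ < 1 then
    ![transmission a b z * jostMinus a b z n * z ^ n, jostPlus a b z n * z ^ (-n)]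
  else
    ![jostPlus a b z⁻¹ n * z ^ n, transmission a b z⁻¹ * jostMinus a b z⁻¹ n * z ^ (-n)]

/-- Punctured neighbourhoods of `z₁` in the open unit disc. -/
noncomputable def nhdsInside (z₁ : ℂ) : Filter ℂ := 𝓝[{z | ‖z‖ < 1 ∧ z ≠ z₁}] z₁

/-- Punctured neighbourhoods of `z₁` in the exterior of the closed unit disc. -/
noncomputable def nhdsOutside (z₁ : ℂ) : Filter ℂ := 𝓝[{z | 1 < ‖z‖ ∧ z ≠ z₁}] z₁

/-- The sectionally meromorphic vector `f` takes the value `(0 0)` at `z₁`: off the unit circle this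
is the value after removing a removable singularity (a pole does not qualify), on the circle
it is the boundary value from at least one of the two sides. -/
def VanishesAt (f : ℂ → Fin 2 → ℂ) (z₁ : ℂ) : Prop :=
  (‖z₁‖ ≤ 1 ∧ Tendsto f (nhdsInside z₁) (𝓝 0)) ∨ (1 ≤ ‖z₁‖ ∧ Tendsto f (nhdsOutside z₁) (𝓝 0))

/-- A zero of exact first order along the filter `l` of approach to `z₁`:
`f(z) = c (z - z₁) + o(|z - z₁|)` with `c ≠ 0`. -/
def SimpleZeroAlong (f : ℂ → ℂ) (z₁ : ℂ) (l : Filter ℂ) : Prop :=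
  ∃ c : ℂ, c ≠ 0 ∧ Tendsto (fun z => f z / (z - z₁)) l (𝓝 c)

/-- The scattering relations: for `|z| = 1`, `z ≠ ±1`, the Wronskian of the Jost solutions does not
vanish, and `T ψ∓ = conj ψ± + R± ψ±` holds with `T = (z⁻¹ - z) / (2 W(ψ₊, ψ₋))`. -/
theorem scattering_relations {a b : ℤ → ℝ} (hpos : Tendsto a atTop (𝓝 (1 / 2)))
    (hneg : Tendsto a atBot (𝓝 (1 / 2))) {z : ℂ} (hz : ‖z‖ = 1) (hz1 : z ≠ 1) (hz2 : z ≠ -1)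
    {u v : ℤ → ℂ} (hu : IsJostPlus a b z u) (hv : IsJostMinus a b z v) :
    jacobiWronskian a u v 0 ≠ 0 ∧ ∃ Rp Rm : ℂ, ∀ n,
      (z⁻¹ - z) / (2 * jacobiWronskian a u v 0) * v n = star (u n) + Rp * u n ∧
      (z⁻¹ - z) / (2 * jacobiWronskian a u v 0) * u n = star (v n) + Rm * v n := by
  have hz0 : z ≠ 0 := by rintro rfl; simp at hz
  have hzc : star z = z⁻¹ := by
    rw [Complex.inv_def, Complex.normSq_eq_norm_sq, hz]; simp
  have hzc2 : star z⁻¹ = z := by rw [← hzc, star_star]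
  -- conjugates are solutions
  have hconj : ∀ w : ℤ → ℂ, IsJacobiSolution a b z w →
      IsJacobiSolution a b z (fun n => star (w n)) := by
    intro w hw n
    have h1 := congrArg star (hw n)
    simp only [jacobiOp, star_add, star_mul', star_div₀, hzc, hzc2] at h1
    simp only [jacobiOp]
    have ha : ∀ x : ℝ, star (x : ℂ) = x := fun x => Complex.conj_ofReal x
    have h2 : star (2 : ℂ) = 2 := by simp
    rw [ha, ha, ha, h2] at h1
    linear_combination h1
  have hpC : Tendsto (fun n => (a n : ℂ)) atTop (𝓝 ((1 / 2 : ℝ) : ℂ)) :=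
    (Complex.continuous_ofReal.tendsto _).comp hpos
  have hnC : Tendsto (fun n => (a n : ℂ)) atBot (𝓝 ((1 / 2 : ℝ) : ℂ)) :=
    (Complex.continuous_ofReal.tendsto _).comp hneg
  have hstarp : ∀ k : ℤ, star (z ^ k) = z ^ (-k) := by
    intro k; rw [star_zpow₀, hzc, inv_zpow, zpow_neg]
  -- the two diagonal Wronskians
  have hWu : jacobiWronskian a u (fun n => star (u n)) 0 = (z⁻¹ - z) / 2 := by
    have hU := hu.2
    have hU1 : Tendsto (fun n : ℤ => z ^ (-(n + 1)) * u (n + 1)) atTop (𝓝 1) :=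
      hU.comp (tendsto_atTop_add_const_right _ 1 tendsto_id)
    have hlim := hpC.mul (((hU.mul hU1.star).const_mul z⁻¹).sub ((hU1.mul hU.star).const_mul z))
    have hlim2 : Tendsto (fun _ : ℤ => jacobiWronskian a u (fun n => star (u n)) 0) atTop
        (𝓝 (((1 / 2 : ℝ) : ℂ) * (z⁻¹ * (1 * star 1) - z * (1 * star 1)))) := by
      refine hlim.congr fun n => ?_
      rw [← jacobiWronskian_eq hu.1 (hconj u hu.1) n]
      simp only [jacobiWronskian, star_mul', hstarp, neg_neg]
      have e1 : z ^ (n + 1) = z ^ n * z := zpow_add_one₀ hz0 n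
      have e2 : z ^ (-(n + 1)) = (z ^ n)⁻¹ * z⁻¹ := by rw [zpow_neg, e1, mul_inv]
      have e3 : z ^ n ≠ 0 := zpow_ne_zero _ hz0
      rw [e1, e2, zpow_neg]
      field_simp
    have := tendsto_nhds_unique hlim2 tendsto_const_nhds
    rw [← this]; simp; ring
  have hWv : jacobiWronskian a v (fun n => star (v n)) 0 = -((z⁻¹ - z) / 2) := by
    have hV := hv.2
    have hV1 : Tendsto (fun n : ℤ => z ^ (n + 1) * v (n + 1)) atBot (𝓝 1) :=
      hV.comp (tendsto_atBot_add_const_right _ 1 tendsto_id)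
    have hlim := hnC.mul (((hV.mul hV1.star).const_mul z).sub ((hV1.mul hV.star).const_mul z⁻¹))
    have hlim2 : Tendsto (fun _ : ℤ => jacobiWronskian a v (fun n => star (v n)) 0) atBot
        (𝓝 (((1 / 2 : ℝ) : ℂ) * (z * (1 * star 1) - z⁻¹ * (1 * star 1)))) := by
      refine hlim.congr fun n => ?_
      rw [← jacobiWronskian_eq hv.1 (hconj v hv.1) n]
      simp only [jacobiWronskian, star_mul', hstarp]
      have e1 : z ^ (n + 1) = z ^ n * z := zpow_add_one₀ hz0 n
      have e2 : z ^ (-(n + 1)) = (z ^ n)⁻¹ * z⁻¹ := by rw [zpow_neg, e1, mul_inv]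
      have e3 : z ^ n ≠ 0 := zpow_ne_zero _ hz0
      rw [e1, e2, zpow_neg]
      field_simp
    have := tendsto_nhds_unique hlim2 tendsto_const_nhds
    rw [← this]; simp; ring
  have hsw : ∀ w w' : ℤ → ℂ, jacobiWronskian a (fun n => star (w n)) (fun n => star (w' n)) 0 =
      star (jacobiWronskian a w w' 0) := by
    intro w w'
    have ha : ∀ x : ℝ, star (x : ℂ) = x := fun x => Complex.conj_ofReal x
    simp only [jacobiWronskian, star_mul', star_sub, ha]
  have hδ : z⁻¹ - z ≠ 0 := by
    intro h0
    have h1 : z * z = 1 := by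
      have := congrArg (· * z) h0
      simp only [sub_mul, inv_mul_cancel₀ hz0, zero_mul] at this
      linear_combination -this
    rcases mul_self_eq_one_iff.1 h1 with h | h
    · exact hz1 h
    · exact hz2 h
  have hW : jacobiWronskian a u v 0 ≠ 0 := by
    intro h0
    set p := jacobiWronskian a u (fun n => star (v n)) 0 with hp
    have hq : jacobiWronskian a (fun n => star (u n)) v 0 = star p := by
      have := hsw u (fun n => star (v n))
      simpa only [star_star] using this
    have pl : jacobiWronskian a u (fun n => star (u n)) 0 *
          jacobiWronskian a v (fun n => star (v n)) 0
        - jacobiWronskian a u v 0 *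
          jacobiWronskian a (fun n => star (u n)) (fun n => star (v n)) 0
        + p * jacobiWronskian a (fun n => star (u n)) v 0 = 0 := by
      rw [hp]; simp only [jacobiWronskian]; ring
    rw [h0, hq, hWu, hWv] at pl
    have hs : star ((z⁻¹ - z) / 2) = -((z⁻¹ - z) / 2) := by
      have h2 : star (2 : ℂ) = 2 := by simp
      rw [star_div₀, star_sub, hzc, hzc2, h2]; ring
    rw [← hs] at pl
    have k : ∀ w : ℂ, w * star w = ((Complex.normSq w : ℝ) : ℂ) := fun w => Complex.mul_conj w
    rw [k, k, zero_mul, sub_zero, ← Complex.ofReal_add, Complex.ofReal_eq_zero] at pl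
    have h3 : 0 < Complex.normSq ((z⁻¹ - z) / 2) :=
      Complex.normSq_pos.2 (div_ne_zero hδ two_ne_zero)
    have h4 := Complex.normSq_nonneg p
    linarith
  refine ⟨hW, -jacobiWronskian a (fun n => star (u n)) v 0 / jacobiWronskian a u v 0,
    -jacobiWronskian a u (fun n => star (v n)) 0 / jacobiWronskian a u v 0, fun n => ⟨?_, ?_⟩⟩
  · have e : (z⁻¹ - z) / 2 * v n = jacobiWronskian a u v 0 * star (u n)
        - jacobiWronskian a (fun n => star (u n)) v 0 * u n := by
      rw [← hWu, ← jacobiWronskian_eq hu.1 (hconj u hu.1) n, ← jacobiWronskian_eq hu.1 hv.1 n,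
        ← jacobiWronskian_eq (hconj u hu.1) hv.1 n]
      simp only [jacobiWronskian]; ring
    have e' : (z⁻¹ - z) * v n = 2 * (jacobiWronskian a u v 0 * star (u n)
        - jacobiWronskian a (fun n => star (u n)) v 0 * u n) := by linear_combination 2 * e
    rw [div_mul_eq_mul_div, e']
    field_simp
    ring
  · have e : (z⁻¹ - z) / 2 * u n = jacobiWronskian a u v 0 * star (v n)
        - jacobiWronskian a u (fun n => star (v n)) 0 * v n := by
      have hWv' : (z⁻¹ - z) / 2 = -jacobiWronskian a v (fun n => star (v n)) 0 := by
        rw [hWv, neg_neg]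
      rw [hWv', ← jacobiWronskian_eq hv.1 (hconj v hv.1) n, ← jacobiWronskian_eq hu.1 hv.1 n,
        ← jacobiWronskian_eq hu.1 (hconj v hv.1) n]
      simp only [jacobiWronskian]; ring
    have e' : (z⁻¹ - z) * u n = 2 * (jacobiWronskian a u v 0 * star (v n)
        - jacobiWronskian a u (fun n => star (v n)) 0 * v n) := by linear_combination 2 * e
    rw [div_mul_eq_mul_div, e']
    field_simp
    ring

/-!
The Volterra equation for `z ^ (-n) * ψ₊(z, n)` is solved in a commutative Banach algebra. In the
algebra of continuous functions on the closed disc, with `z` the identity function, this makes the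
Jost functions continuous up to the circle, with summable errors even at `z = ±1`.

Green's formula expresses the Wronskian of `ψ₊(w, ·)` and `ψ₊(z, ·)` as `(z - w) / 2` times a sum
over a half-line which, after Abel regularisation, extends continuously to the closed disc and is
positive for `w = conj z`. Hence the zeros of `ψ₊(·, n)` in the closed disc are real and simple, and
there `a n * ψ₊(n + 1)` and the derivative of `ψ₊(n)` have opposite signs; by reflection they have
equal signs for `ψ₋`. At a common zero of `ψ₊(·, n)` and `ψ₋(·, n)` the Wronskian `W` therefore has
a simple zero, so wherever `ψ₊(·, n)` vanishes the quotient `ψ₋(·, n) / W` has a nonzero limit.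
There the component `T * ψ₋ * z ^ n` can only vanish through the factor `z⁻¹ - z` of `T`.
-/

section Volterra

variable {B : Type*}

/-- The Abel-weighted tail sum `∑_{k ≥ 0} x ^ k * s (n + k)` of a sequence `s`; for `x = 1` it is
the plain tail of the series `∑ s`. -/
noncomputable def tailSum [NormedRing B] (x : B) (s : ℕ → B) (n : ℕ) : B :=
  ∑' k, x ^ k * s (n + k)

lemma tailSum_shift [NormedRing B] (x : B) (s : ℕ → B) (N n : ℕ) :
    tailSum x (fun k => s (N + k)) n = tailSum x s (N + n) := by
  simp only [tailSum, add_assoc]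

lemma tailSum_one_nonneg {c : ℕ → ℝ} (hc : ∀ k, 0 ≤ c k) (n : ℕ) : 0 ≤ tailSum 1 c n :=
  tsum_nonneg fun k => by simpa only [one_pow, one_mul] using hc (n + k)

open Finset.HasAntidiagonal (antidiagonal mem_antidiagonal) in
lemma summable_succ_pow_mul_tailSum {c : ℕ → ℝ} (hc : ∀ k, 0 ≤ c k) (m : ℕ)
    (h : Summable fun k : ℕ => ((k : ℝ) + 1) ^ (m + 1) * c k) :
    Summable fun k : ℕ => ((k : ℝ) + 1) ^ m * tailSum 1 c k := by
  let F : ℕ × ℕ → ℝ := fun p => ((p.1 : ℝ) + 1) ^ m * c (p.1 + p.2)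
  have hF : 0 ≤ F := fun p => mul_nonneg (by positivity) (hc _)
  have antidiagonal_le (n : ℕ) :
      ∑ p ∈ antidiagonal n, F p ≤ ((n : ℝ) + 1) ^ (m + 1) * c n := by
    calc ∑ p ∈ antidiagonal n, F p
        ≤ ∑ p ∈ antidiagonal n, ((n : ℝ) + 1) ^ m * c n := by
          refine Finset.sum_le_sum fun p hp => ?_
          obtain rfl := mem_antidiagonal.1 hp
          refine mul_le_mul_of_nonneg_right ?_ (hc _)
          push_cast
          gcongr
          linarith [Nat.cast_nonneg (α := ℝ) p.2]
      _ = ((n : ℝ) + 1) ^ (m + 1) * c n := by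
          rw [Finset.sum_const, Finset.Nat.card_antidiagonal, nsmul_eq_mul]
          push_cast
          ring
  have hsum : Summable F := by
    rw [← Finset.HasAntidiagonal.sigmaAntidiagonalEquivProd.summable_iff]
    refine (summable_sigma_of_nonneg fun p => hF _).2 ⟨fun n => Summable.of_finite,
      h.of_nonneg_of_le (fun n => tsum_nonneg fun p => hF _) fun n => ?_⟩
    rw [tsum_fintype]
    exact (Finset.sum_coe_sort (antidiagonal n) F).trans_le (antidiagonal_le n)
  refine hsum.prod.congr fun k => ?_
  simp only [F, tailSum, one_pow, one_mul, tsum_mul_left]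

section NormedRing

variable [NormedRing B] [NormOneClass B] {x : B} {s s' : ℕ → B} {c : ℕ → ℝ}
  {M : ℝ}

lemma norm_pow_mul_le_norm (hx : ‖x‖ ≤ 1) (k : ℕ) (y : B) : ‖x ^ k * y‖ ≤ ‖y‖ :=
  (norm_mul_le _ _).trans <| mul_le_of_le_one_left (norm_nonneg y) <|
    (norm_pow_le x k).trans (pow_le_one₀ (norm_nonneg x) hx)

lemma norm_tailSum_le (hx : ‖x‖ ≤ 1) (hc : Summable c) (hs : ∀ k, ‖s k‖ ≤ M * c k) (n : ℕ) :
    ‖tailSum x s n‖ ≤ M * tailSum 1 c n := by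
  have hcn : Summable fun k => c (n + k) := by
    simpa only [add_comm n] using (summable_nat_add_iff n).2 hc
  refine tsum_of_norm_bounded (g := fun k => M * c (n + k)) ?_
    fun k => (norm_pow_mul_le_norm hx k _).trans (hs _)
  simpa only [tailSum, one_pow, one_mul] using hcn.hasSum.mul_left M

variable [CompleteSpace B]

lemma summable_pow_mul (hx : ‖x‖ ≤ 1) (hs : Summable fun k => ‖s k‖) (n : ℕ) :
    Summable fun k => x ^ k * s (n + k) := by
  refine Summable.of_norm_bounded (g := fun k => ‖s (n + k)‖) ?_
    fun k => norm_pow_mul_le_norm hx k _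
  simpa only [add_comm n] using (summable_nat_add_iff n).2 hs

lemma tailSum_eq_add (hx : ‖x‖ ≤ 1) (hs : Summable fun k => ‖s k‖) (n : ℕ) :
    tailSum x s n = s n + x * tailSum x s (n + 1) := by
  rw [tailSum, (summable_pow_mul hx hs n).tsum_eq_zero_add, tailSum,
    ← (summable_pow_mul hx hs (n + 1)).tsum_mul_left]
  simp only [pow_zero, one_mul, add_zero, pow_succ', mul_assoc, add_assoc, add_comm 1]

lemma tailSum_sub (hx : ‖x‖ ≤ 1) (hs : Summable fun k => ‖s k‖)
    (hs' : Summable fun k => ‖s' k‖) (n : ℕ) :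
    tailSum x (s - s') n = tailSum x s n - tailSum x s' n := by
  rw [tailSum, tailSum, tailSum, ← (summable_pow_mul hx hs n).tsum_sub (summable_pow_mul hx hs' n)]
  simp only [Pi.sub_apply, mul_sub]

end NormedRing

section NormedCommRing

variable [NormedCommRing B] {x : B} {p r : ℕ → B} {q : ℕ → ℝ} {M : ℝ} {g g' : ℕ → B}

/-- The inhomogeneity which coefficients `p`, `r` add to the free recurrence
`g (n + 1) - g n = x * (g (n + 2) - g (n + 1))`. -/
def perturbationTerm (x : B) (p r g : ℕ → B) (k : ℕ) : B :=
  x * (p k * (g k + g (k + 1))) + r k * g k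

/-- The summand of the Volterra equation `g n = 1 - ∑_{k ≥ n} volterraTerm x p r g k`, which encodes
the perturbed recurrence together with the normalisation `g → 1` at infinity. -/
noncomputable def volterraTerm (x : B) (p r g : ℕ → B) (k : ℕ) : B :=
  p k * g k + tailSum x (perturbationTerm x p r g) (k + 1)

lemma perturbationTerm_sub (x : B) (p r g g' : ℕ → B) :
    perturbationTerm x p r (g - g') = perturbationTerm x p r g - perturbationTerm x p r g' := by
  ext k
  simp only [perturbationTerm, Pi.sub_apply]
  ring

lemma norm_perturbationTerm_le (hx : ‖x‖ ≤ 1) (hq : ∀ k, 2 * ‖p k‖ + ‖r k‖ ≤ q k)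
    (hg : ∀ k, ‖g k‖ ≤ M) (k : ℕ) : ‖perturbationTerm x p r g k‖ ≤ M * q k := by
  have hM : 0 ≤ M := (norm_nonneg _).trans (hg 0)
  calc ‖perturbationTerm x p r g k‖
      ≤ 1 * (‖p k‖ * (M + M)) + ‖r k‖ * M :=
        norm_add_le_of_le (norm_mul_le_of_le hx <| norm_mul_le_of_le le_rfl <|
          norm_add_le_of_le (hg k) (hg (k + 1))) (norm_mul_le_of_le le_rfl (hg k))
    _ = M * (2 * ‖p k‖ + ‖r k‖) := by ring
    _ ≤ M * q k := by gcongr; exact hq k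

lemma summable_norm_perturbationTerm (hx : ‖x‖ ≤ 1) (hq : ∀ k, 2 * ‖p k‖ + ‖r k‖ ≤ q k)
    (hqs : Summable q) (hg : ∀ k, ‖g k‖ ≤ M) :
    Summable fun k => ‖perturbationTerm x p r g k‖ :=
  (hqs.mul_left M).of_nonneg_of_le (fun _ => norm_nonneg _) (norm_perturbationTerm_le hx hq hg)

variable [NormOneClass B]

lemma norm_volterraTerm_le (hx : ‖x‖ ≤ 1) (hq : ∀ k, 2 * ‖p k‖ + ‖r k‖ ≤ q k) (hqs : Summable q)
    (hg : ∀ k, ‖g k‖ ≤ M) (k : ℕ) : ‖volterraTerm x p r g k‖ ≤ M * tailSum 1 q k := by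
  have hq0 : ∀ k, 0 ≤ q k := fun k => le_trans (by positivity) (hq k)
  have hp : ‖p k‖ ≤ q k := by linarith [hq k, norm_nonneg (p k), norm_nonneg (r k)]
  calc ‖volterraTerm x p r g k‖
      ≤ q k * M + M * tailSum 1 q (k + 1) := norm_add_le_of_le (norm_mul_le_of_le hp (hg k))
        (norm_tailSum_le hx hqs (norm_perturbationTerm_le hx hq hg) (k + 1))
    _ = M * tailSum 1 q k := by
        rw [tailSum_eq_add norm_one.le (hqs.congr fun k => (Real.norm_of_nonneg (hq0 k)).symm) k]
        ring

lemma summable_norm_volterraTerm (hx : ‖x‖ ≤ 1) (hq : ∀ k, 2 * ‖p k‖ + ‖r k‖ ≤ q k)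
    (hqs : Summable q) (hτ : Summable (tailSum 1 q)) (hg : ∀ k, ‖g k‖ ≤ M) :
    Summable fun k => ‖volterraTerm x p r g k‖ :=
  (hτ.mul_left M).of_nonneg_of_le (fun _ => norm_nonneg _) (norm_volterraTerm_le hx hq hqs hg)

lemma norm_tailSum_volterraTerm_le (hx : ‖x‖ ≤ 1) (hq : ∀ k, 2 * ‖p k‖ + ‖r k‖ ≤ q k)
    (hqs : Summable q) (hτ : Summable (tailSum 1 q)) (hg : ∀ k, ‖g k‖ ≤ M) (n : ℕ) :
    ‖tailSum 1 (volterraTerm x p r g) n‖ ≤ M * tailSum 1 (tailSum 1 q) n :=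
  norm_tailSum_le norm_one.le hτ (norm_volterraTerm_le hx hq hqs hg) n

variable [CompleteSpace B]

lemma volterraTerm_sub (hx : ‖x‖ ≤ 1) (hg : Summable fun k => ‖perturbationTerm x p r g k‖)
    (hg' : Summable fun k => ‖perturbationTerm x p r g' k‖) :
    volterraTerm x p r (g - g') = volterraTerm x p r g - volterraTerm x p r g' := by
  ext k
  simp only [volterraTerm, perturbationTerm_sub, tailSum_sub hx hg hg', Pi.sub_apply]
  ring

lemma tailSum_volterraTerm_sub (hx : ‖x‖ ≤ 1) (hq : ∀ k, 2 * ‖p k‖ + ‖r k‖ ≤ q k)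
    (hqs : Summable q) (hτ : Summable (tailSum 1 q)) {M' : ℝ} (hg : ∀ k, ‖g k‖ ≤ M)
    (hg' : ∀ k, ‖g' k‖ ≤ M') (n : ℕ) :
    tailSum 1 (volterraTerm x p r (g - g')) n =
      tailSum 1 (volterraTerm x p r g) n - tailSum 1 (volterraTerm x p r g') n := by
  rw [← tailSum_sub norm_one.le (summable_norm_volterraTerm hx hq hqs hτ hg)
    (summable_norm_volterraTerm hx hq hqs hτ hg'),
    ← volterraTerm_sub hx (summable_norm_perturbationTerm hx hq hqs hg)
    (summable_norm_perturbationTerm hx hq hqs hg')]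

lemma recurrence_of_volterra (hx : ‖x‖ ≤ 1)
    (hs : Summable fun k => ‖perturbationTerm x p r g k‖)
    (hv : Summable fun k => ‖volterraTerm x p r g k‖)
    (h : ∀ n, g n = 1 - tailSum 1 (volterraTerm x p r g) n) (n : ℕ) :
    (1 + p n) * g n = (1 + x - r (n + 1)) * g (n + 1) - (1 + p (n + 1)) * x * g (n + 2) := by
  have increment (k : ℕ) : g (k + 1) - g k =
      p k * g k + tailSum x (perturbationTerm x p r g) (k + 1) := by
    have htail := tailSum_eq_add norm_one.le hv k
    rw [volterraTerm] at htail
    linear_combination h (k + 1) - h k + htail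
  have hsource := tailSum_eq_add hx hs (n + 1)
  rw [perturbationTerm] at hsource
  linear_combination -increment n + x * increment (n + 1) - hsource

open BoundedContinuousFunction in
lemma exists_eq_one_sub_volterra (hx : ‖x‖ ≤ 1) (hq : ∀ k, 2 * ‖p k‖ + ‖r k‖ ≤ q k)
    (hqs : Summable q) (hτ : Summable (tailSum 1 q))
    (hsmall : ∀ n, tailSum 1 (tailSum 1 q) n ≤ 1 / 2) :
    ∃ g : ℕ → B, (∀ n, ‖g n‖ ≤ 2) ∧ ∀ n, g n = 1 - tailSum 1 (volterraTerm x p r g) n := by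
  have tailSum_le {M : ℝ} {g : ℕ → B} (hg : ∀ k, ‖g k‖ ≤ M) (n : ℕ) :
      ‖tailSum 1 (volterraTerm x p r g) n‖ ≤ 1 / 2 * M := by
    rw [mul_comm]
    exact (norm_tailSum_volterraTerm_le hx hq hqs hτ hg n).trans <|
      mul_le_mul_of_nonneg_left (hsmall n) ((norm_nonneg _).trans (hg 0))
  let Φ : (ℕ →ᵇ B) → (ℕ →ᵇ B) := fun g =>
    ofNormedAddCommGroupDiscrete (fun n => 1 - tailSum 1 (volterraTerm x p r g) n)
      (1 + 1 / 2 * ‖g‖) fun n => (norm_sub_le _ _).trans <| by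
        rw [norm_one]; gcongr; exact tailSum_le g.norm_coe_le_norm n
  have contracting : ContractingWith (1 / 2) Φ := by
    refine ⟨NNReal.half_lt_self one_ne_zero, LipschitzWith.of_dist_le_mul fun g g' => ?_⟩
    refine (dist_le (by positivity)).2 fun n => ?_
    change dist (1 - tailSum 1 (volterraTerm x p r g) n)
      (1 - tailSum 1 (volterraTerm x p r g') n) ≤ _
    rw [dist_sub_left, dist_eq_norm, ← tailSum_volterraTerm_sub hx hq hqs hτ
      g.norm_coe_le_norm g'.norm_coe_le_norm]
    exact tailSum_le (M := dist g g') (fun k => by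
      rw [Pi.sub_apply, ← dist_eq_norm]; exact dist_coe_le_dist k) n
  obtain ⟨g, hg⟩ : ∃ g, Φ g = g := ⟨_, contracting.fixedPoint_isFixedPt⟩
  have hfix (n : ℕ) : g n = 1 - tailSum 1 (volterraTerm x p r g) n := congr($(hg) n).symm
  have hnorm : ‖g‖ ≤ 1 + 1 / 2 * ‖g‖ := (norm_le (by positivity)).2 fun n => by
    rw [hfix n]
    exact (norm_sub_le _ _).trans (by rw [norm_one]; gcongr; exact tailSum_le g.norm_coe_le_norm n)
  exact ⟨g, fun n => (g.norm_coe_le_norm n).trans (by linarith), hfix⟩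

end NormedCommRing

end Volterra

lemma summable_tailSum_of_succ_sq {c : ℕ → ℝ} (hc : ∀ k, 0 ≤ c k)
    (h : Summable fun k : ℕ => ((k : ℝ) + 1) ^ 2 * c k) :
    Summable c ∧ Summable (tailSum 1 c) ∧ Summable (tailSum 1 (tailSum 1 c)) := by
  have hτ := summable_succ_pow_mul_tailSum hc 1 h
  have hττ := summable_succ_pow_mul_tailSum (tailSum_one_nonneg hc) 0 hτ
  have of_weighted {d : ℕ → ℝ} (hd : ∀ k, 0 ≤ d k) {m : ℕ}
      (hs : Summable fun k : ℕ => ((k : ℝ) + 1) ^ m * d k) : Summable d :=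
    hs.of_nonneg_of_le hd fun k =>
      le_mul_of_one_le_left (hd k) (one_le_pow₀ (by linarith [Nat.cast_nonneg (α := ℝ) k]))
  exact ⟨of_weighted hc h, of_weighted (tailSum_one_nonneg hc) hτ,
    of_weighted (tailSum_one_nonneg (tailSum_one_nonneg hc)) hττ⟩

lemma exists_halfLine_solution {B : Type*} [NormedCommRing B] [NormOneClass B] [CompleteSpace B]
    [NormedAlgebra ℝ B] {a b : ℕ → ℝ}
    (h : Summable fun k : ℕ => ((k : ℝ) + 1) ^ 2 * (|a k - 1 / 2| + |b k|)) {z : B}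
    (hz : ‖z‖ ≤ 1) :
    ∃ (N : ℕ) (g : ℕ → B), (Summable fun k => ‖g k - 1‖) ∧
      ∀ n, (2 * a (N + n)) • g n = (1 + z ^ 2) * g (n + 1)
        - (2 * b (N + n + 1)) • (z * g (n + 1)) - (2 * a (N + n + 1)) • (z ^ 2 * g (n + 2)) := by
  set q : ℕ → ℝ := fun k => 4 * (|a k - 1 / 2| + |b k|) with hq_def
  obtain ⟨hqs, hτ, hττ⟩ := summable_tailSum_of_succ_sq (c := q) (fun k => by positivity)
    ((h.mul_left 4).congr fun k => by rw [hq_def]; ring)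
  obtain ⟨N, hN⟩ := eventually_atTop.1
    (hττ.tendsto_atTop_zero.eventually_le_const (by norm_num : (0 : ℝ) < 1 / 2))
  have hττN (n : ℕ) : tailSum 1 (tailSum 1 fun k => q (N + k)) n =
      tailSum 1 (tailSum 1 q) (N + n) := by
    rw [← tailSum_shift, funext (tailSum_shift 1 q N)]
  have hshift {c : ℕ → ℝ} (hc : Summable c) : Summable fun k => c (N + k) := by
    simpa only [add_comm N] using (summable_nat_add_iff N).2 hc
  have hx : ‖z ^ 2‖ ≤ 1 := (norm_pow_le z 2).trans (pow_le_one₀ (norm_nonneg z) hz)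
  let p (k : ℕ) : B := algebraMap ℝ B (2 * a (N + k) - 1)
  let r (k : ℕ) : B := algebraMap ℝ B (2 * b (N + k)) * z
  have hpr (k : ℕ) : 2 * ‖p k‖ + ‖r k‖ ≤ q (N + k) := by
    have hr : ‖r k‖ ≤ |2 * b (N + k)| * 1 :=
      norm_mul_le_of_le (norm_algebraMap' B (2 * b (N + k))).le hz
    have hp : ‖p k‖ = 2 * |a (N + k) - 1 / 2| := by
      rw [norm_algebraMap', Real.norm_eq_abs, ← abs_two, ← abs_mul]
      ring_nf
    rw [abs_mul, abs_two] at hr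
    linarith [abs_nonneg (b (N + k))]
  have hqsN := hshift hqs
  have hτN : Summable (tailSum 1 fun k => q (N + k)) :=
    (hshift hτ).congr fun n => (tailSum_shift 1 q N n).symm
  obtain ⟨g, hg2, hg⟩ := exists_eq_one_sub_volterra hx hpr hqsN hτN
    fun n => (hττN n).trans_le (hN _ (Nat.le_add_right N n))
  refine ⟨N, g, ?_, fun n => ?_⟩
  · refine ((hshift hττ).mul_left 2).of_nonneg_of_le (fun k => norm_nonneg _) fun k => ?_
    rw [hg k, sub_sub_cancel_left, norm_neg, ← hττN]
    exact norm_tailSum_volterraTerm_le hx hpr hqsN hτN hg2 k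
  · have hrec := recurrence_of_volterra hx (summable_norm_perturbationTerm hx hpr hqsN hg2)
      (summable_norm_volterraTerm hx hpr hqsN hτN hg2) hg n
    simp only [p, r, map_sub, map_one, ← add_assoc] at hrec
    simp only [Algebra.smul_def]
    linear_combination hrec

lemma exists_backward_extension {X : Type*} (step : ℤ → X → X → X) (N : ℤ) (G : ℕ → X) :
    ∃ f : ℤ → X, (∀ k : ℕ, f (N + k) = G k) ∧ ∀ n < N, f n = step n (f (n + 1)) (f (n + 2)) := by
  let F : ℕ → X × X :=
    Nat.rec (G 0, G 1) fun j x => (step (N - j - 1) x.1 x.2, x.1)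
  let f : ℤ → X := fun n => if N ≤ n then G (n - N).toNat else (F (N - n).toNat).1
  have hright (k : ℕ) : f (N + k) = G k := by simp [f]
  have hleft (j : ℕ) : f (N - j) = (F j).1 := by
    rcases j with _ | j
    · simp [f, F]
    · simp [f, show ¬ N ≤ N - (j + 1) by omega]
  have hleft_succ (j : ℕ) : f (N - j + 1) = (F j).2 := by
    rcases j with _ | j
    · simpa [F] using hright 1
    · rw [Nat.cast_succ, sub_add_eq_sub_sub, sub_add_cancel, hleft]
  refine ⟨f, hright, fun n hn => ?_⟩
  obtain ⟨j, hj⟩ := Int.eq_ofNat_of_zero_le (show 0 ≤ N - n - 1 by omega)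
  obtain rfl : n = N - ((j + 1 : ℕ) : ℤ) := by push_cast; omega
  rw [hleft, show N - ((j + 1 : ℕ) : ℤ) + 1 = N - j by push_cast; ring,
    show N - ((j + 1 : ℕ) : ℤ) + 2 = N - j + 1 by push_cast; ring, hleft, hleft_succ,
    Nat.cast_succ, sub_add_eq_sub_sub]

lemma summable_intCast_add_shift {c : ℤ → ℝ} {N : ℤ} (h : Summable fun k : ℕ => c (N + k)) (n : ℤ) :
    Summable fun k : ℕ => c (n + k) := by
  obtain ⟨i, j, hij⟩ : ∃ i j : ℕ, N + i = n + j := ⟨(n - N).toNat, (N - n).toNat, by omega⟩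
  rw [← summable_nat_add_iff j]
  refine ((summable_nat_add_iff i).2 h).congr fun k => ?_
  push_cast
  congr 1
  omega

/-- The Jacobi operator is nondegenerate and differs from the free one (`a = 1 / 2`, `b = 0`) by
coefficients with a finite second moment. -/
structure JacobiSecondMoment (a b : ℤ → ℝ) : Prop where
  ne_zero : ∀ n, a n ≠ 0
  summable : Summable fun n : ℤ => (1 + (n : ℝ) ^ 2) * (|a n - 1 / 2| + |b n|)

lemma JacobiDecay.jacobiSecondMoment {a b : ℤ → ℝ} (h : JacobiDecay a b) :
    JacobiSecondMoment a b where
  ne_zero n := (h.pos n).ne'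
  summable := ((h.summable 0).add (h.summable 2)).congr fun n => by rw [sq_abs]; ring

lemma exists_fullLine_solution {B : Type*} [NormedCommRing B] [NormOneClass B] [CompleteSpace B]
    [NormedAlgebra ℝ B] {a b : ℤ → ℝ} (h : JacobiSecondMoment a b) {z : B} (hz : ‖z‖ ≤ 1) :
    ∃ F : ℤ → B, (∀ n, Summable fun k : ℕ => ‖F (n + k) - 1‖) ∧
      ∀ n, (2 * a n) • F n = (1 + z ^ 2) * F (n + 1)
        - (2 * b (n + 1)) • (z * F (n + 1)) - (2 * a (n + 1)) • (z ^ 2 * F (n + 2)) := by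
  have hmoment : Summable fun k : ℕ => ((k : ℝ) + 1) ^ 2 * (|a k - 1 / 2| + |b k|) := by
    refine ((h.summable.comp_injective Nat.cast_injective).mul_left 2).of_nonneg_of_le
      (fun k => by positivity) fun k => ?_
    rw [Function.comp_apply, Int.cast_natCast, ← mul_assoc]
    gcongr
    nlinarith [sq_nonneg ((k : ℝ) - 1)]
  obtain ⟨N, g, hg, hrec⟩ := exists_halfLine_solution hmoment hz
  obtain ⟨F, hF, hback⟩ := exists_backward_extension (fun n y y' => (2 * a n)⁻¹ •
    ((1 + z ^ 2) * y - (2 * b (n + 1)) • (z * y) - (2 * a (n + 1)) • (z ^ 2 * y'))) N g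
  refine ⟨F, summable_intCast_add_shift (c := fun n => ‖F n - 1‖) (N := N) ?_, fun n => ?_⟩
  · simpa only [hF] using hg
  · rcases lt_or_ge n N with hn | hn
    · rw [hback n hn, smul_inv_smul₀ (mul_ne_zero two_ne_zero (h.ne_zero n))]
    · obtain ⟨k, rfl⟩ := Int.le.dest hn
      have hF1 := hF (k + 1)
      have hF2 := hF (k + 2)
      have hreck := hrec k
      push_cast at hF1 hF2 hreck
      rw [add_assoc (N : ℤ), add_assoc (N : ℤ), hF, hF1, hF2, hreck, add_assoc]

/-- The normalised Jost solutions `f n z = z ^ (-n) * ψ₊(z, n)`, extended continuously to `z = 0`.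
Summability of the error, uniformly in `z`, is what allows limits at `z = ±1` to be taken without
any restriction on the approach. -/
structure IsJostFamily (a b : ℤ → ℝ) (f : ℤ → ℂ → ℂ) : Prop where
  recurrence : ∀ n, ∀ z ∈ Metric.closedBall (0 : ℂ) 1, 2 * a n * f n z =
    (1 + z ^ 2 - 2 * b (n + 1) * z) * f (n + 1) z - 2 * a (n + 1) * z ^ 2 * f (n + 2) z
  continuousOn : ∀ n, ContinuousOn (f n) (Metric.closedBall 0 1)
  exists_summable_bound : ∀ n, ∃ e : ℕ → ℝ, Summable e ∧
    ∀ z ∈ Metric.closedBall (0 : ℂ) 1, ∀ k : ℕ, ‖f (n + k) z - 1‖ ≤ e k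

lemma exists_isJostFamily {a b : ℤ → ℝ} (h : JacobiSecondMoment a b) :
    ∃ f, IsJostFamily a b f := by
  let disc := Metric.closedBall (0 : ℂ) 1
  let id_disc : C(disc, ℂ) := ⟨Subtype.val, continuous_subtype_val⟩
  have hid : ‖id_disc‖ ≤ 1 := (ContinuousMap.norm_le _ zero_le_one).2 fun z =>
    mem_closedBall_zero_iff.1 z.2
  obtain ⟨F, hF, hrec⟩ := exists_fullLine_solution h hid
  let f (n : ℤ) : ℂ → ℂ := Function.extend Subtype.val (F n) 0
  have hf (n : ℤ) (z : disc) : f n z = F n z := Subtype.val_injective.extend_apply _ _ _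
  refine ⟨f, fun n z hz => ?_, fun n => ?_, fun n => ⟨_, hF n, fun z hz k => ?_⟩⟩
  · lift z to disc using hz
    have heval := congr($(hrec n) z)
    simp only [ContinuousMap.smul_apply, ContinuousMap.sub_apply, ContinuousMap.mul_apply,
      ContinuousMap.add_apply, ContinuousMap.one_apply, ContinuousMap.pow_apply, id_disc,
      ContinuousMap.coe_mk, Complex.real_smul] at heval
    push_cast at heval
    rw [hf, hf, hf]
    linear_combination heval
  · rw [continuousOn_iff_continuous_domRestrict]
    exact (F n).continuous.congr fun z => (hf n z).symm
  · lift z to disc using hz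
    rw [hf]
    exact (F (n + k) - 1).norm_coe_le_norm z

section JostSolutions

variable {a b : ℤ → ℝ} {z w : ℂ} {u v : ℤ → ℂ}

lemma JacobiSecondMoment.tendsto_cofinite (h : JacobiSecondMoment a b) :
    Tendsto a cofinite (𝓝 (1 / 2)) := by
  rw [tendsto_iff_norm_sub_tendsto_zero]
  refine squeeze_zero (fun _ => norm_nonneg _) (fun n => ?_) h.summable.tendsto_cofinite_zero
  have hab := add_nonneg (abs_nonneg (a n - 1 / 2)) (abs_nonneg (b n))
  rw [Real.norm_eq_abs]
  nlinarith [abs_nonneg (b n), mul_nonneg (sq_nonneg (n : ℝ)) hab]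

lemma JacobiSecondMoment.tendsto_atTop (h : JacobiSecondMoment a b) :
    Tendsto a atTop (𝓝 (1 / 2)) :=
  h.tendsto_cofinite.mono_left (Int.cofinite_eq ▸ le_sup_right)

lemma tendsto_intCast_add_natCast (n : ℤ) : Tendsto (fun k : ℕ => n + (k : ℤ)) atTop atTop :=
  tendsto_atTop_add_const_left _ _ tendsto_natCast_atTop_atTop

lemma tendsto_int_atTop_iff {X : Type*} {l : Filter X} {g : ℤ → X} (n : ℤ) :
    Tendsto g atTop l ↔ Tendsto (fun k : ℕ => g (n + k)) atTop l := by
  refine ⟨fun hg => hg.comp (tendsto_intCast_add_natCast n), fun hg => ?_⟩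
  have hcast : Tendsto (fun m : ℤ => (m - n).toNat) atTop atTop :=
    tendsto_atTop.2 fun k => (eventually_ge_atTop (n + k)).mono fun m hm => by omega
  refine (hg.comp hcast).congr' ((eventually_ge_atTop n).mono fun m hm => congrArg g ?_)
  dsimp only
  omega

lemma IsJacobiSolution.eq_zero (ha : ∀ n, a n ≠ 0) (hu : IsJacobiSolution a b z u) {n : ℤ}
    (h0 : u n = 0) (h1 : u (n + 1) = 0) (m : ℤ) : u m = 0 := by
  have ha' (n : ℤ) : (a n : ℂ) ≠ 0 := Complex.ofReal_ne_zero.2 (ha n)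
  suffices hm : u m = 0 ∧ u (m + 1) = 0 from hm.1
  induction m using Int.inductionOn' (b := n) with
  | zero => exact ⟨h0, h1⟩
  | succ m _ ih => exact ⟨ih.2, by simpa [jacobiOp, ih, ha'] using hu (m + 1)⟩
  | pred m _ ih => exact ⟨by simpa [jacobiOp, ih, ha'] using hu m, by simpa using ih.1⟩

lemma IsJacobiSolution.mul_eq_mul_of_wronskian_eq_zero (ha : ∀ n, a n ≠ 0)
    (hu : IsJacobiSolution a b z u) (hv : IsJacobiSolution a b z v) {m : ℤ}
    (hW : jacobiWronskian a u v m = 0) (n : ℤ) : u n * v m = v n * u m := by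
  have hdiff : IsJacobiSolution a b z fun n => u n * v m - v n * u m := fun n => by
    have hun := hu n
    have hvn := hv n
    simp only [jacobiOp] at hun hvn ⊢
    linear_combination v m * hun - u m * hvn
  have hW' := (mul_eq_zero.1 hW).resolve_left (Complex.ofReal_ne_zero.2 (ha m))
  refine sub_eq_zero.1 (hdiff.eq_zero ha (n := m) ?_ ?_ n)
  · ring
  · linear_combination -hW'

lemma IsJacobiSolution.wronskian_sub_wronskian_succ (hu : IsJacobiSolution a b z u)
    (hv : IsJacobiSolution a b w v) (n : ℤ) :
    jacobiWronskian a u v n - jacobiWronskian a u v (n + 1) =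
      ((z + z⁻¹) / 2 - (w + w⁻¹) / 2) * (u (n + 1) * v (n + 1)) := by
  have hun := hu (n + 1)
  have hvn := hv (n + 1)
  simp only [jacobiOp, add_sub_cancel_right] at hun hvn
  simp only [jacobiWronskian]
  linear_combination v (n + 1) * hun - u (n + 1) * hvn

lemma IsJostPlus.tendsto_zpow_mul_wronskian (ha : Tendsto a atTop (𝓝 (1 / 2))) (hz : z ≠ 0)
    (hw : w ≠ 0) (hu : IsJostPlus a b z u) (hv : IsJostPlus a b w v) :
    Tendsto (fun n => (z * w) ^ (-n) * jacobiWronskian a u v n) atTop (𝓝 ((w - z) / 2)) := by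
  have hsucc : Tendsto (fun n : ℤ => n + 1) atTop atTop :=
    tendsto_atTop_add_const_right _ 1 tendsto_id
  have haC : Tendsto (fun n => (a n : ℂ)) atTop (𝓝 ((1 / 2 : ℝ) : ℂ)) :=
    (Complex.continuous_ofReal.tendsto _).comp ha
  have hlim := haC.mul (((hu.2.mul (hv.2.comp hsucc)).const_mul w).sub
    (((hu.2.comp hsucc).mul hv.2).const_mul z))
  convert hlim.congr fun n => ?_ using 2
  · push_cast
    ring
  · have hzn : z ^ n ≠ 0 := zpow_ne_zero _ hz
    have hwn : w ^ n ≠ 0 := zpow_ne_zero _ hw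
    simp only [jacobiWronskian, Function.comp_apply, zpow_neg, zpow_add_one₀ hz,
      zpow_add_one₀ hw, mul_zpow]
    field_simp

lemma one_le_norm_zpow_neg {x : ℂ} (hx0 : x ≠ 0) (hx : ‖x‖ ≤ 1) {n : ℤ} (hn : 0 ≤ n) :
    1 ≤ ‖x ^ (-n)‖ := by
  lift n to ℕ using hn
  rw [zpow_neg, norm_inv, zpow_natCast, norm_pow]
  exact (one_le_inv₀ (pow_pos (norm_pos_iff.2 hx0) n)).2 (pow_le_one₀ (norm_nonneg x) hx)

lemma IsJostPlus.unique (ha0 : ∀ n, a n ≠ 0) (ha : Tendsto a atTop (𝓝 (1 / 2))) (hz0 : z ≠ 0)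
    (hz : ‖z‖ ≤ 1) (hu : IsJostPlus a b z u) (hv : IsJostPlus a b z v) : u = v := by
  have hzz : ‖z * z‖ ≤ 1 := (norm_mul_le_of_le hz hz).trans (mul_one (1 : ℝ)).le
  have hW (m : ℤ) : jacobiWronskian a u v m = 0 := by
    have hlim := (hu.tendsto_zpow_mul_wronskian ha hz0 hz0 hv).norm
    rw [sub_self, zero_div, norm_zero] at hlim
    refine norm_le_zero_iff.1 (ge_of_tendsto hlim ((eventually_ge_atTop 0).mono fun n hn => ?_))
    rw [jacobiWronskian_eq hu.1 hv.1 m, ← jacobiWronskian_eq hu.1 hv.1 n, norm_mul]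
    exact le_mul_of_one_le_left (norm_nonneg _)
      (one_le_norm_zpow_neg (mul_ne_zero hz0 hz0) hzz hn)
  have hprop (m n : ℤ) := hu.1.mul_eq_mul_of_wronskian_eq_zero ha0 hv.1 (hW m) n
  have heq (m : ℤ) : v m = u m := by
    have hlim := (hu.2.mul_const (v m)).congr fun n => by rw [mul_assoc, hprop m n, ← mul_assoc]
    simpa only [one_mul] using tendsto_nhds_unique hlim (hv.2.mul_const (u m))
  exact funext fun m => (heq m).symm

lemma IsJostPlus.star (hu : IsJostPlus a b z u) :
    IsJostPlus a b (star z) fun n => star (u n) := by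
  have hreal (x : ℝ) : Star.star (x : ℂ) = x := Complex.conj_ofReal x
  refine ⟨fun n => ?_, by simpa only [star_mul', star_zpow₀, star_one] using hu.2.star⟩
  simpa only [jacobiOp, star_add, star_mul', star_div₀, star_inv₀, hreal, star_ofNat]
    using congr(Star.star $(hu.1 n))

lemma IsJostPlus.exists_ne_zero (hu : IsJostPlus a b z u) (n : ℤ) : ∃ k : ℕ, u (n + k) ≠ 0 :=
  (((tendsto_int_atTop_iff n).1 hu.2).eventually_ne one_ne_zero).exists.imp
    fun _ hk => right_ne_zero_of_mul hk

lemma IsJostPlus.succ_ne_zero (ha : ∀ n, a n ≠ 0) (hu : IsJostPlus a b z u) {n : ℤ}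
    (hn : u n = 0) : u (n + 1) ≠ 0 := fun hn1 =>
  let ⟨_, hk⟩ := hu.exists_ne_zero n
  hk (hu.1.eq_zero ha hn hn1 _)

end JostSolutions

section JostFamily

variable {a b : ℤ → ℝ} {f : ℤ → ℂ → ℂ} {z : ℂ}

lemma IsJostFamily.tendsto_one (hf : IsJostFamily a b f) (hz : ‖z‖ ≤ 1) :
    Tendsto (fun n => f n z) atTop (𝓝 1) := by
  obtain ⟨e, he, hbound⟩ := hf.exists_summable_bound 0
  rw [tendsto_int_atTop_iff 0, tendsto_iff_norm_sub_tendsto_zero]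
  exact squeeze_zero (fun _ => norm_nonneg _) (hbound z (mem_closedBall_zero_iff.2 hz))
    he.tendsto_atTop_zero

lemma IsJostFamily.isJostPlus (hf : IsJostFamily a b f) (hz0 : z ≠ 0) (hz : ‖z‖ ≤ 1) :
    IsJostPlus a b z fun n => z ^ n * f n z := by
  refine ⟨fun n => ?_, (hf.tendsto_one hz).congr fun n => ?_⟩
  · have hrec := hf.recurrence (n - 1) z (mem_closedBall_zero_iff.2 hz)
    rw [sub_add_cancel, show n - 1 + 2 = n + 1 by ring] at hrec
    simp only [jacobiOp, zpow_add_one₀ hz0, zpow_sub_one₀ hz0]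
    field_simp
    linear_combination hrec
  · rw [zpow_neg, inv_mul_cancel_left₀ (zpow_ne_zero n hz0)]

lemma JacobiSecondMoment.isJostPlus_jostPlus (h : JacobiSecondMoment a b) (hz0 : z ≠ 0)
    (hz : ‖z‖ ≤ 1) : IsJostPlus a b z (jostPlus a b z) :=
  let ⟨_, hf⟩ := exists_isJostFamily h
  Classical.epsilon_spec (p := IsJostPlus a b z) ⟨_, hf.isJostPlus hz0 hz⟩

lemma JacobiSecondMoment.eq_jostPlus (h : JacobiSecondMoment a b) (hz0 : z ≠ 0) (hz : ‖z‖ ≤ 1)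
    {u : ℤ → ℂ} (hu : IsJostPlus a b z u) : u = jostPlus a b z :=
  hu.unique h.ne_zero h.tendsto_atTop hz0 hz (h.isJostPlus_jostPlus hz0 hz)

lemma IsJostFamily.jostPlus_eq (hf : IsJostFamily a b f) (h : JacobiSecondMoment a b)
    (hz0 : z ≠ 0) (hz : ‖z‖ ≤ 1) (n : ℤ) : jostPlus a b z n = z ^ n * f n z :=
  congr($(h.eq_jostPlus hz0 hz (hf.isJostPlus hz0 hz)) n).symm

lemma JacobiSecondMoment.jostPlus_star (h : JacobiSecondMoment a b) (hz0 : z ≠ 0)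
    (hz : ‖z‖ ≤ 1) (n : ℤ) : jostPlus a b (star z) n = star (jostPlus a b z n) :=
  congr($(h.eq_jostPlus (star_ne_zero.2 hz0) ((norm_star z).trans_le hz)
    (h.isJostPlus_jostPlus hz0 hz).star) n).symm

lemma JacobiSecondMoment.continuousOn_jostPlus (h : JacobiSecondMoment a b) (n : ℤ) :
    ContinuousOn (fun z => jostPlus a b z n) (Metric.closedBall 0 1 \ {0}) := by
  obtain ⟨f, hf⟩ := exists_isJostFamily h
  refine ContinuousOn.congr (f := fun z => z ^ n * f n z) ?_
    fun z hz => hf.jostPlus_eq h hz.2 (mem_closedBall_zero_iff.1 hz.1) n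
  exact (continuousOn_id.zpow₀ n fun z hz => Or.inl hz.2).mul
    ((hf.continuousOn n).mono Set.sdiff_subset)

end JostFamily

section JostPairing

/-- Abel regularisation of `(1 - w * z) * ∑_{k ≥ 0} (w * z) ^ k * f (n + k) w * f (n + k) z`, which
remains meaningful and continuous up to the circle `‖w * z‖ = 1`. -/
noncomputable def jostPairing (f : ℤ → ℂ → ℂ) (n : ℤ) (w z : ℂ) : ℂ :=
  1 + (1 - w * z) * ∑' k : ℕ, (w * z) ^ k * (f (n + k) w * f (n + k) z - 1)

variable {a b : ℤ → ℝ} {f : ℤ → ℂ → ℂ} {z w : ℂ}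

lemma IsJostFamily.exists_summable_bound_mul (hf : IsJostFamily a b f) (n : ℤ) :
    ∃ e : ℕ → ℝ, Summable e ∧ ∀ w ∈ Metric.closedBall (0 : ℂ) 1,
      ∀ z ∈ Metric.closedBall (0 : ℂ) 1, ∀ k : ℕ,
        ‖(w * z) ^ k * (f (n + k) w * f (n + k) z - 1)‖ ≤ e k := by
  obtain ⟨e, he, hbound⟩ := hf.exists_summable_bound n
  have he0 (k : ℕ) : 0 ≤ e k := (norm_nonneg _).trans (hbound 0 (by simp) k)
  refine ⟨fun k => ((∑' j, e j) + 2) * e k, he.mul_left _, fun w hw z hz k => ?_⟩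
  have hwz : ‖w * z‖ ≤ 1 := (norm_mul_le_of_le (mem_closedBall_zero_iff.1 hw)
    (mem_closedBall_zero_iff.1 hz)).trans (mul_one (1 : ℝ)).le
  calc ‖(w * z) ^ k * (f (n + k) w * f (n + k) z - 1)‖
      ≤ ‖(f (n + k) w - 1) * (f (n + k) z - 1) + (f (n + k) w - 1) + (f (n + k) z - 1)‖ :=
        (norm_pow_mul_le_norm hwz k _).trans (le_of_eq (by ring_nf))
    _ ≤ e k * e k + e k + e k :=
        norm_add₃_le.trans (add_le_add_three (norm_mul_le_of_le (hbound w hw k) (hbound z hz k))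
          (hbound w hw k) (hbound z hz k))
    _ ≤ ((∑' j, e j) + 2) * e k := by
        nlinarith [he0 k, he.le_tsum k fun j _ => he0 j]

lemma IsJostFamily.summable_pairing (hf : IsJostFamily a b f) (n : ℤ) (hw : ‖w‖ ≤ 1)
    (hz : ‖z‖ ≤ 1) : Summable fun k : ℕ => (w * z) ^ k * (f (n + k) w * f (n + k) z - 1) :=
  let ⟨_, he, hbound⟩ := hf.exists_summable_bound_mul n
  he.of_norm_bounded (hbound w (mem_closedBall_zero_iff.2 hw) z (mem_closedBall_zero_iff.2 hz))

lemma IsJostFamily.continuousOn_jostPairing (hf : IsJostFamily a b f) (n : ℤ) (hw : ‖w‖ ≤ 1) :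
    ContinuousOn (jostPairing f n w) (Metric.closedBall 0 1) := by
  obtain ⟨e, he, hbound⟩ := hf.exists_summable_bound_mul n
  have hmul : ContinuousOn (fun z => w * z) (Metric.closedBall 0 1) := by fun_prop
  refine continuousOn_const.add ((continuousOn_const.sub hmul).mul ?_)
  exact continuousOn_tsum (fun k => (hmul.pow k).mul
      ((continuousOn_const.mul (hf.continuousOn (n + k))).sub continuousOn_const)) he
    fun k z hz => hbound w (mem_closedBall_zero_iff.2 hw) z hz k

lemma IsJostFamily.hasSum_jostPairing (hf : IsJostFamily a b f) (n : ℤ) (hw : ‖w‖ ≤ 1)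
    (hz : ‖z‖ ≤ 1) (hwz : ‖w * z‖ < 1) :
    HasSum (fun k : ℕ => (1 - w * z) * ((w * z) ^ k * (f (n + k) w * f (n + k) z)))
      (jostPairing f n w z) := by
  have hgeom := (hasSum_geometric_of_norm_lt_one hwz).mul_left (1 - w * z)
  have hne : 1 - w * z ≠ 0 := sub_ne_zero.2 fun h => by simp [← h] at hwz
  rw [mul_inv_cancel₀ hne] at hgeom
  refine (hgeom.add ((hf.summable_pairing n hw hz).hasSum.mul_left (1 - w * z))).congr_fun ?_
  exact fun k => by ring

lemma IsJostFamily.zpow_mul_wronskian_eq (hf : IsJostFamily a b f) (h : JacobiSecondMoment a b)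
    (hw0 : w ≠ 0) (hw : ‖w‖ ≤ 1) (hz0 : z ≠ 0) (hz : ‖z‖ ≤ 1) (n : ℤ) :
    (w * z) ^ (-n) * jacobiWronskian a (jostPlus a b w) (jostPlus a b z) n =
      w * z * ((w * z) ^ (-(n + 1)) *
        jacobiWronskian a (jostPlus a b w) (jostPlus a b z) (n + 1)) +
      (z - w) / 2 * (1 - w * z) * (f (n + 1) w * f (n + 1) z) := by
  have hx0 : w * z ≠ 0 := mul_ne_zero hw0 hz0
  have hxn : (w * z) ^ n ≠ 0 := zpow_ne_zero n hx0
  have hstep := (h.isJostPlus_jostPlus hw0 hw).1.wronskian_sub_wronskian_succ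
    (h.isJostPlus_jostPlus hz0 hz).1 n
  rw [hf.jostPlus_eq h hw0 hw, hf.jostPlus_eq h hz0 hz, mul_mul_mul_comm, ← mul_zpow,
    sub_eq_iff_eq_add] at hstep
  simp only [hstep, zpow_neg, zpow_add_one₀ hx0]
  field_simp
  ring

lemma IsJostFamily.wronskian_eq_jostPairing (hf : IsJostFamily a b f) (h : JacobiSecondMoment a b)
    (hw0 : w ≠ 0) (hw : ‖w‖ ≤ 1) (hz0 : z ≠ 0) (hz : ‖z‖ ≤ 1) (n : ℤ) :
    jacobiWronskian a (jostPlus a b w) (jostPlus a b z) n =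
      (z - w) / 2 * (w * z) ^ n * jostPairing f (n + 1) w z := by
  have hx0 : w * z ≠ 0 := mul_ne_zero hw0 hz0
  let V (m : ℤ) : ℂ := (w * z) ^ (-m) * jacobiWronskian a (jostPlus a b w) (jostPlus a b z) m
  let s (k : ℕ) : ℂ := (w * z) ^ k * (f (n + 1 + k) w * f (n + 1 + k) z - 1)
  have hpartial (K : ℕ) : V n = (z - w) / 2 * (1 + (1 - w * z) * ∑ k ∈ Finset.range K, s k)
      + (w * z) ^ K * (V (n + K) - (z - w) / 2) := by
    induction K with
    | zero => simp
    | succ K ih =>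
      have hVK : V (n + K) = _ := hf.zpow_mul_wronskian_eq h hw0 hw hz0 hz (n + K)
      rw [add_right_comm n (K : ℤ) 1] at hVK
      rw [ih, Finset.sum_range_succ, Nat.cast_succ, ← add_assoc, add_right_comm n (K : ℤ) 1]
      linear_combination (w * z) ^ K * hVK
  have hremainder : Tendsto (fun K : ℕ => (w * z) ^ K * (V (n + K) - (z - w) / 2)) atTop (𝓝 0) := by
    have hVlim := ((h.isJostPlus_jostPlus hw0 hw).tendsto_zpow_mul_wronskian h.tendsto_atTop hw0 hz0
      (h.isJostPlus_jostPlus hz0 hz)).comp (tendsto_intCast_add_natCast n)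
    exact squeeze_zero_norm
      (fun K => norm_pow_mul_le_norm ((norm_mul_le_of_le hw hz).trans_eq (mul_one 1)) K _)
      (tendsto_iff_norm_sub_tendsto_zero.1 hVlim)
  have hlim := ((((hf.summable_pairing (n + 1) hw hz).hasSum.tendsto_sum_nat.const_mul
    (1 - w * z)).const_add 1).const_mul ((z - w) / 2)).add hremainder
  have hVn : V n = (z - w) / 2 * jostPairing f (n + 1) w z := by
    rw [← add_zero ((z - w) / 2 * _)]
    exact tendsto_nhds_unique (tendsto_const_nhds.congr hpartial) hlim
  rw [mul_right_comm, ← hVn, mul_comm]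
  simp only [V, zpow_neg, mul_inv_cancel_left₀ (zpow_ne_zero n hx0)]

lemma IsJostFamily.apply_star (hf : IsJostFamily a b f) (h : JacobiSecondMoment a b)
    (hz0 : z ≠ 0) (hz : ‖z‖ ≤ 1) (n : ℤ) : f n (star z) = star (f n z) := by
  have hstar := h.jostPlus_star hz0 hz n
  rw [hf.jostPlus_eq h hz0 hz, hf.jostPlus_eq h (star_ne_zero.2 hz0) ((norm_star z).trans_le hz),
    star_mul', star_zpow₀] at hstar
  exact mul_left_cancel₀ (zpow_ne_zero n (star_ne_zero.2 hz0)) hstar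

lemma IsJostFamily.jostPairing_star_pos (hf : IsJostFamily a b f) (h : JacobiSecondMoment a b)
    (hz0 : z ≠ 0) (hz : ‖z‖ ≤ 1) (n : ℤ) :
    ∃ r : ℝ, 0 < r ∧ jostPairing f n z (star z) = r := by
  have hzz : z * star z = ((‖z‖ ^ 2 : ℝ) : ℂ) := by push_cast; exact Complex.mul_conj' z
  rcases hz.eq_or_lt with hz1 | hz1
  · refine ⟨1, one_pos, ?_⟩
    rw [jostPairing, hzz, hz1]
    simp
  have hlt : ‖z‖ ^ 2 < 1 := pow_lt_one₀ (norm_nonneg z) hz1 two_ne_zero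
  let t (k : ℕ) : ℝ := (1 - ‖z‖ ^ 2) * ((‖z‖ ^ 2) ^ k * ‖f (n + k) z‖ ^ 2)
  have ht0 (k : ℕ) : 0 ≤ t k := mul_nonneg (sub_nonneg.2 hlt.le) (by positivity)
  have hsum : HasSum (fun k => (t k : ℂ)) (jostPairing f n z (star z)) := by
    convert hf.hasSum_jostPairing n hz ((norm_star z).trans_le hz) ?_ using 2 with k
    · rw [hf.apply_star h hz0 hz, hzz]
      have hff := Complex.mul_conj' (f (n + k) z)
      simp only [t]
      push_cast
      rw [← hff]
      rfl
    · rwa [hzz, Complex.norm_real, Real.norm_of_nonneg (sq_nonneg _)]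
  obtain ⟨k, hk⟩ := (hf.isJostPlus hz0 hz).exists_ne_zero n
  refine ⟨∑' k, t k, (Complex.summable_ofReal.1 hsum.summable).tsum_pos ht0 k ?_, ?_⟩
  · have hfk := norm_pos_iff.2 (right_ne_zero_of_mul hk)
    exact mul_pos (sub_pos.2 hlt) (mul_pos (pow_pos (pow_pos (norm_pos_iff.2 hz0) 2) k)
      (pow_pos hfk 2))
  · rw [Complex.ofReal_tsum, hsum.tsum_eq]

lemma JacobiSecondMoment.star_eq_of_jostPlus_eq_zero (h : JacobiSecondMoment a b) (hz0 : z ≠ 0)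
    (hz : ‖z‖ ≤ 1) {n : ℤ} (hn : jostPlus a b z n = 0) : star z = z := by
  obtain ⟨f, hf⟩ := exists_isJostFamily h
  obtain ⟨r, hr, hpair⟩ := hf.jostPairing_star_pos h hz0 hz (n + 1)
  have hstar0 := star_ne_zero.2 hz0
  have hgreen := hf.wronskian_eq_jostPairing h hz0 hz hstar0 ((norm_star z).trans_le hz) n
  rw [jacobiWronskian, h.jostPlus_star hz0 hz n, hn, hpair, star_zero, zero_mul, mul_zero, sub_zero,
    mul_zero, eq_comm] at hgreen
  have hr' : (r : ℂ) ≠ 0 := Complex.ofReal_ne_zero.2 hr.ne'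
  have hzn : (z * star z) ^ n ≠ 0 := zpow_ne_zero n (mul_ne_zero hz0 hstar0)
  have hsub := (mul_eq_zero.1 ((mul_eq_zero.1 hgreen).resolve_right hr')).resolve_right hzn
  exact sub_eq_zero.1 ((div_eq_zero_iff.1 hsub).resolve_right two_ne_zero)

end JostPairing

section NhdsInside

lemma eventually_nhdsInside (z₁ : ℂ) : ∀ᶠ z in nhdsInside z₁, ‖z‖ < 1 ∧ z ≠ z₁ :=
  self_mem_nhdsWithin

lemma nhdsInside_le_nhds (z₁ : ℂ) : nhdsInside z₁ ≤ 𝓝 z₁ := nhdsWithin_le_nhds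

lemma eventually_ne_zero_nhdsInside (z₁ : ℂ) : ∀ᶠ z in nhdsInside z₁, z ≠ 0 := by
  rcases eq_or_ne z₁ 0 with rfl | hz₁
  · exact (eventually_nhdsInside 0).mono fun z hz => hz.2
  · exact nhdsInside_le_nhds z₁ (eventually_ne_nhds hz₁)

lemma nhdsInside_le_nhdsWithin_disc (z₁ : ℂ) :
    nhdsInside z₁ ≤ 𝓝[Metric.closedBall 0 1 \ {0}] z₁ :=
  le_inf (nhdsInside_le_nhds z₁) <| le_principal_iff.2 <|
    ((eventually_nhdsInside z₁).and (eventually_ne_zero_nhdsInside z₁)).mono fun _ hz =>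
      ⟨mem_closedBall_zero_iff.2 hz.1.1.le, hz.2⟩

lemma nhdsInside_neBot {z₁ : ℂ} (hz : ‖z₁‖ ≤ 1) : (nhdsInside z₁).NeBot := by
  have hset : {z : ℂ | ‖z‖ < 1 ∧ z ≠ z₁} = Metric.ball 0 1 ∩ {z₁}ᶜ := by
    ext z
    simp
  rw [nhdsInside, hset, ← mem_closure_iff_nhdsWithin_neBot]
  refine closure_minimal ((dense_compl_singleton z₁).open_subset_closure_inter Metric.isOpen_ball)
    isClosed_closure ?_
  rw [closure_ball 0 one_ne_zero]
  exact mem_closedBall_zero_iff.2 hz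

end NhdsInside

section JostZeros

variable {a b : ℤ → ℝ} {z₁ : ℂ} {n : ℤ}

lemma JacobiSecondMoment.tendsto_jostPlus (h : JacobiSecondMoment a b) (hz0 : z₁ ≠ 0)
    (hz : ‖z₁‖ ≤ 1) (n : ℤ) :
    Tendsto (fun z => jostPlus a b z n) (nhdsInside z₁) (𝓝 (jostPlus a b z₁ n)) :=
  ((h.continuousOn_jostPlus n).continuousWithinAt
    ⟨mem_closedBall_zero_iff.2 hz, hz0⟩).mono_left (nhdsInside_le_nhdsWithin_disc z₁)

lemma JacobiSecondMoment.exists_tendsto_jostPlus_div (h : JacobiSecondMoment a b) (hz0 : z₁ ≠ 0)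
    (hz : ‖z₁‖ ≤ 1) (hn : jostPlus a b z₁ n = 0) :
    ∃ r : ℝ, r < 0 ∧ Tendsto (fun z => a n * jostPlus a b z₁ (n + 1) *
      (jostPlus a b z n / (z - z₁))) (nhdsInside z₁) (𝓝 r) := by
  obtain ⟨f, hf⟩ := exists_isJostFamily h
  have hreal := h.star_eq_of_jostPlus_eq_zero hz0 hz hn
  obtain ⟨r, hr, hpair⟩ := hf.jostPairing_star_pos h hz0 hz (n + 1)
  rw [hreal] at hpair
  lift z₁ to ℝ using Complex.conj_eq_iff_im.1 hreal
  have hre0 : z₁ ≠ 0 := Complex.ofReal_ne_zero.1 hz0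
  have hpos : 0 < (z₁ * z₁) ^ n := zpow_pos (mul_self_pos.2 hre0) n
  refine ⟨-((z₁ * z₁) ^ n * r / 2), by linarith [mul_pos hpos hr], ?_⟩
  have hpairing : Tendsto (jostPairing f (n + 1) z₁) (nhdsInside z₁) (𝓝 r) := hpair ▸
    ((hf.continuousOn_jostPairing (n + 1) hz).continuousWithinAt
      (mem_closedBall_zero_iff.2 hz)).mono_left
      ((nhdsInside_le_nhdsWithin_disc _).trans (nhdsWithin_mono _ Set.sdiff_subset))
  have hpow : Tendsto (fun z : ℂ => (z₁ * z) ^ n) (nhdsInside z₁) (𝓝 ((z₁ * z₁) ^ n)) :=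
    ((continuousAt_const.mul continuousAt_id).zpow₀ n
      (Or.inl (mul_ne_zero hz0 hz0))).tendsto.mono_left (nhdsInside_le_nhds _)
  have hlim := ((hpow.mul hpairing).div_const 2).neg
  push_cast
  refine hlim.congr' ?_
  filter_upwards [eventually_nhdsInside (z₁ : ℂ), eventually_ne_zero_nhdsInside (z₁ : ℂ)]
    with z hz' hz'0
  have hgreen := hf.wronskian_eq_jostPairing h hz0 hz hz'0 hz'.1.le n
  rw [jacobiWronskian, hn] at hgreen
  rw [mul_div_assoc', eq_div_iff (sub_ne_zero.2 hz'.2)]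
  linear_combination hgreen

end JostZeros

section Reflection

/-- The off-diagonal coefficients of the Jacobi operator conjugated by `n ↦ -n`: the coefficient
`a n` couples the sites `n` and `n + 1`, hence the shift by one. -/
def reflectOff (a : ℤ → ℝ) (n : ℤ) : ℝ := a (-n - 1)

/-- The diagonal coefficients of the Jacobi operator conjugated by `n ↦ -n`. -/
def reflectDiag (b : ℤ → ℝ) (n : ℤ) : ℝ := b (-n)

variable {a b : ℤ → ℝ} {z z₁ : ℂ} {n : ℤ}

lemma JacobiSecondMoment.reflect (h : JacobiSecondMoment a b) :
    JacobiSecondMoment (reflectOff a) (reflectDiag b) where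
  ne_zero n := h.ne_zero (-n - 1)
  summable := by
    have hsum (m : ℤ) : Summable fun n : ℤ =>
        (1 + ((-n - m : ℤ) : ℝ) ^ 2) * (|a (-n - m) - 1 / 2| + |b (-n - m)|) :=
      ((Equiv.neg ℤ).trans (Equiv.subRight m)).summable_iff.2 h.summable
    refine .of_nonneg_of_le (fun n => by positivity) (fun n => ?_)
      (((hsum 1).mul_left 3).add (hsum 0))
    have hA := abs_nonneg (a (-n - 1) - 1 / 2)
    have hB := abs_nonneg (b (-n - 1))
    have hA' := abs_nonneg (a (-n) - 1 / 2)
    simp only [reflectOff, reflectDiag, sub_zero]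
    push_cast
    nlinarith [mul_nonneg (by positivity : 0 ≤ 3 * (1 + (-(n : ℝ) - 1) ^ 2)) hB,
      mul_nonneg (by positivity : 0 ≤ 1 + (n : ℝ) ^ 2) hA',
      mul_nonneg (by nlinarith [sq_nonneg (2 * (n : ℝ) + 3)] :
        0 ≤ 3 * (1 + (-(n : ℝ) - 1) ^ 2) - (1 + (n : ℝ) ^ 2)) hA]

lemma isJostMinus_iff_isJostPlus_reflect {u : ℤ → ℂ} :
    IsJostMinus a b z u ↔ IsJostPlus (reflectOff a) (reflectDiag b) z fun n => u (-n) := by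
  have hop (n : ℤ) : jacobiOp (reflectOff a) (reflectDiag b) (fun n => u (-n)) n =
      jacobiOp a b u (-n) := by
    simp only [jacobiOp, reflectOff, reflectDiag, neg_add', neg_sub', sub_neg_eq_add,
      add_sub_cancel_right]
    ring
  refine and_congr ?_ ?_
  · rw [IsJacobiSolution, IsJacobiSolution, (Equiv.neg ℤ).forall_congr_left]
    simp only [hop, Equiv.neg_symm, Equiv.neg_apply]
  · rw [← Filter.map_neg_atTop, tendsto_map'_iff]
    rfl

lemma JacobiSecondMoment.isJostMinus_jostMinus (h : JacobiSecondMoment a b) (hz0 : z ≠ 0)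
    (hz : ‖z‖ ≤ 1) : IsJostMinus a b z (jostMinus a b z) := by
  refine Classical.epsilon_spec (p := IsJostMinus a b z)
    ⟨fun n => jostPlus (reflectOff a) (reflectDiag b) z (-n), ?_⟩
  simpa only [isJostMinus_iff_isJostPlus_reflect, neg_neg] using
    h.reflect.isJostPlus_jostPlus hz0 hz

lemma JacobiSecondMoment.jostMinus_eq (h : JacobiSecondMoment a b) (hz0 : z ≠ 0) (hz : ‖z‖ ≤ 1)
    (n : ℤ) : jostMinus a b z n = jostPlus (reflectOff a) (reflectDiag b) z (-n) := by
  have hminus := isJostMinus_iff_isJostPlus_reflect.1 (h.isJostMinus_jostMinus hz0 hz)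
  simpa only [neg_neg] using congrFun (h.reflect.eq_jostPlus hz0 hz hminus) (-n)

lemma JacobiSecondMoment.jostMinus_star (h : JacobiSecondMoment a b) (hz0 : z ≠ 0)
    (hz : ‖z‖ ≤ 1) (n : ℤ) : jostMinus a b (star z) n = star (jostMinus a b z n) := by
  rw [h.jostMinus_eq hz0 hz, h.jostMinus_eq (star_ne_zero.2 hz0) ((norm_star z).trans_le hz),
    h.reflect.jostPlus_star hz0 hz]

lemma JacobiSecondMoment.tendsto_jostMinus (h : JacobiSecondMoment a b) (hz0 : z₁ ≠ 0)
    (hz : ‖z₁‖ ≤ 1) (n : ℤ) :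
    Tendsto (fun z => jostMinus a b z n) (nhdsInside z₁) (𝓝 (jostMinus a b z₁ n)) := by
  rw [h.jostMinus_eq hz0 hz]
  refine (h.reflect.tendsto_jostPlus hz0 hz (-n)).congr' ?_
  filter_upwards [eventually_nhdsInside z₁, eventually_ne_zero_nhdsInside z₁] with z hz' hz'0
  exact (h.jostMinus_eq hz'0 hz'.1.le n).symm

lemma JacobiSecondMoment.mul_jostMinus_succ (h : JacobiSecondMoment a b) (hz0 : z ≠ 0)
    (hz : ‖z‖ ≤ 1) (hn : jostMinus a b z n = 0) : a n * jostMinus a b z (n + 1) =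
      -(reflectOff a (-n) * jostPlus (reflectOff a) (reflectDiag b) z (-n + 1)) := by
  have hjacobi := (h.isJostMinus_jostMinus hz0 hz).1 n
  rw [jacobiOp, hn, mul_zero, mul_zero, add_zero, h.jostMinus_eq hz0 hz (n - 1), neg_sub',
    sub_neg_eq_add] at hjacobi
  rw [reflectOff, neg_neg]
  exact eq_neg_of_add_eq_zero_left hjacobi

lemma JacobiSecondMoment.jostMinus_succ_ne_zero (h : JacobiSecondMoment a b) (hz0 : z ≠ 0)
    (hz : ‖z‖ ≤ 1) (hn : jostMinus a b z n = 0) : jostMinus a b z (n + 1) ≠ 0 := by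
  have hn' := h.jostMinus_eq hz0 hz n ▸ hn
  refine right_ne_zero_of_mul (a := (a n : ℂ)) ?_
  rw [h.mul_jostMinus_succ hz0 hz hn]
  exact neg_ne_zero.2 (mul_ne_zero (Complex.ofReal_ne_zero.2 (h.reflect.ne_zero _))
    ((h.reflect.isJostPlus_jostPlus hz0 hz).succ_ne_zero h.reflect.ne_zero hn'))

lemma JacobiSecondMoment.exists_tendsto_jostMinus_div (h : JacobiSecondMoment a b) (hz0 : z₁ ≠ 0)
    (hz : ‖z₁‖ ≤ 1) (hn : jostMinus a b z₁ n = 0) :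
    ∃ r : ℝ, 0 < r ∧ Tendsto (fun z => a n * jostMinus a b z₁ (n + 1) *
      (jostMinus a b z n / (z - z₁))) (nhdsInside z₁) (𝓝 r) := by
  obtain ⟨r, hr, hlim⟩ :=
    h.reflect.exists_tendsto_jostPlus_div hz0 hz (h.jostMinus_eq hz0 hz n ▸ hn)
  refine ⟨-r, neg_pos.2 hr, ?_⟩
  rw [h.mul_jostMinus_succ hz0 hz hn, Complex.ofReal_neg]
  refine hlim.neg.congr' ?_
  filter_upwards [eventually_nhdsInside z₁, eventually_ne_zero_nhdsInside z₁] with z hz' hz'0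
  rw [h.jostMinus_eq hz'0 hz'.1.le, neg_mul]

end Reflection

section JostWronskian

/-- The Wronskian `W(z)` of the two Jost functions, for `0 < |z| ≤ 1`. -/
noncomputable def jostWronskian (a b : ℤ → ℝ) (z : ℂ) : ℂ :=
  jacobiWronskian a (jostPlus a b z) (jostMinus a b z) 0

variable {a b : ℤ → ℝ} {z z₁ : ℂ} {n : ℤ}

lemma JacobiSecondMoment.jostWronskian_eq (h : JacobiSecondMoment a b) (hz0 : z ≠ 0)
    (hz : ‖z‖ ≤ 1) (n : ℤ) :
    jostWronskian a b z = jacobiWronskian a (jostPlus a b z) (jostMinus a b z) n :=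
  (jacobiWronskian_eq (h.isJostPlus_jostPlus hz0 hz).1 (h.isJostMinus_jostMinus hz0 hz).1 n).symm

lemma JacobiSecondMoment.tendsto_jostWronskian (h : JacobiSecondMoment a b) (hz0 : z₁ ≠ 0)
    (hz : ‖z₁‖ ≤ 1) : Tendsto (jostWronskian a b) (nhdsInside z₁) (𝓝 (jostWronskian a b z₁)) :=
  (((h.tendsto_jostPlus hz0 hz 0).mul (h.tendsto_jostMinus hz0 hz (0 + 1))).sub
    ((h.tendsto_jostPlus hz0 hz (0 + 1)).mul (h.tendsto_jostMinus hz0 hz 0))).const_mul _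

/-- Normalised to the value `1` at `n + 1`, the two Jost functions at `n` cross a common zero in
opposite directions, so the two terms of the Wronskian cannot cancel to first order. -/
lemma JacobiSecondMoment.exists_tendsto_jostWronskian_div (h : JacobiSecondMoment a b)
    (hz0 : z₁ ≠ 0) (hz : ‖z₁‖ ≤ 1) (hplus : jostPlus a b z₁ n = 0)
    (hminus : jostMinus a b z₁ n = 0) :
    ∃ s : ℂ, s ≠ 0 ∧ Tendsto (fun z => jostPlus a b z₁ (n + 1) * jostMinus a b z₁ (n + 1) *
      (jostWronskian a b z / (z - z₁))) (nhdsInside z₁) (𝓝 s) := by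
  have hreal := h.star_eq_of_jostPlus_eq_zero hz0 hz hplus
  have hplus1 := (h.isJostPlus_jostPlus hz0 hz).succ_ne_zero h.ne_zero hplus
  have hminus1 := h.jostMinus_succ_ne_zero hz0 hz hminus
  obtain ⟨p, hp⟩ := Complex.conj_eq_iff_real.1
    ((h.jostPlus_star hz0 hz (n + 1)).symm.trans (by rw [hreal]))
  obtain ⟨q, hq⟩ := Complex.conj_eq_iff_real.1
    ((h.jostMinus_star hz0 hz (n + 1)).symm.trans (by rw [hreal]))
  obtain ⟨r, hr, hlimp⟩ := h.exists_tendsto_jostPlus_div hz0 hz hplus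
  obtain ⟨s, hs, hlimq⟩ := h.exists_tendsto_jostMinus_div hz0 hz hminus
  have hneg : r * (q * q) - s * (p * p) < 0 := by
    have hp0 : p ≠ 0 := Complex.ofReal_ne_zero.1 (hp ▸ hplus1)
    have hq0 : q ≠ 0 := Complex.ofReal_ne_zero.1 (hq ▸ hminus1)
    linarith [mul_pos_of_neg_of_neg hr (neg_lt_zero.2 (mul_self_pos.2 hq0)),
      mul_pos hs (mul_self_pos.2 hp0)]
  refine ⟨_, Complex.ofReal_ne_zero.2 hneg.ne, ?_⟩
  push_cast
  rw [← hp, ← hq]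
  refine ((hlimp.mul ((h.tendsto_jostMinus hz0 hz (n + 1)).const_mul _)).sub
    (hlimq.mul ((h.tendsto_jostPlus hz0 hz (n + 1)).const_mul _))).congr' ?_
  filter_upwards [eventually_nhdsInside z₁, eventually_ne_zero_nhdsInside z₁] with z hz' hz'0
  rw [h.jostWronskian_eq hz'0 hz'.1.le n, jacobiWronskian]
  ring

lemma JacobiSecondMoment.exists_tendsto_jostMinus_div_jostWronskian (h : JacobiSecondMoment a b)
    (hz0 : z₁ ≠ 0) (hz : ‖z₁‖ ≤ 1) (hplus : jostPlus a b z₁ n = 0) :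
    ∃ c : ℂ, c ≠ 0 ∧
      Tendsto (fun z => jostMinus a b z n / jostWronskian a b z) (nhdsInside z₁) (𝓝 c) := by
  have ha : (a n : ℂ) ≠ 0 := Complex.ofReal_ne_zero.2 (h.ne_zero n)
  have hplus1 := (h.isJostPlus_jostPlus hz0 hz).succ_ne_zero h.ne_zero hplus
  have hW := h.jostWronskian_eq hz0 hz n
  rw [jacobiWronskian, hplus, zero_mul, zero_sub] at hW
  by_cases hminus : jostMinus a b z₁ n = 0
  · have hminus1 := h.jostMinus_succ_ne_zero hz0 hz hminus
    obtain ⟨r, hr, hlim⟩ := h.exists_tendsto_jostMinus_div hz0 hz hminus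
    obtain ⟨s, hs, hlimW⟩ := h.exists_tendsto_jostWronskian_div hz0 hz hplus hminus
    have hr' : (r : ℂ) ≠ 0 := Complex.ofReal_ne_zero.2 hr.ne'
    refine ⟨r * (jostPlus a b z₁ (n + 1) / a n) / s,
      div_ne_zero (mul_ne_zero hr' (div_ne_zero hplus1 ha)) hs,
      ((hlim.mul_const _).div hlimW hs).congr' ?_⟩
    filter_upwards [eventually_nhdsInside z₁] with z hz'
    have hsub := sub_ne_zero.2 hz'.2
    rw [Pi.div_apply]
    field_simp
  · have hW0 : jostWronskian a b z₁ ≠ 0 := by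
      rw [hW]
      exact mul_ne_zero ha (neg_ne_zero.2 (mul_ne_zero hplus1 hminus))
    exact ⟨_, div_ne_zero hminus hW0,
      (h.tendsto_jostMinus hz0 hz n).div (h.tendsto_jostWronskian hz0 hz) hW0⟩

end JostWronskian

section JostVector

variable {a b : ℤ → ℝ} {z z₁ : ℂ} {n : ℤ}

lemma IsJostFamily.apply_zero_ne_zero {f : ℤ → ℂ → ℂ} (hf : IsJostFamily a b f) (n : ℤ) :
    f n 0 ≠ 0 := fun hn => by
  have hzero (k : ℕ) : f (n + k) 0 = 0 := by
    induction k with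
    | zero => simpa using hn
    | succ k ih => simpa [ih, ← add_assoc, eq_comm] using hf.recurrence (n + k) 0 (by simp)
  have hlim := (tendsto_int_atTop_iff n).1 (hf.tendsto_one (norm_zero.trans_le zero_le_one))
  simp only [hzero] at hlim
  exact zero_ne_one (tendsto_nhds_unique tendsto_const_nhds hlim)

lemma jostVector_zero_of_norm_lt_one (hz : ‖z‖ < 1) : jostVector a b n z 0 =
    jostMinus a b z n / jostWronskian a b z * ((z⁻¹ - z) / 2 * z ^ n) := by
  simp only [jostVector, if_pos hz, transmission, jostWronskian, Matrix.cons_val_zero]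
  ring

lemma jostVector_one_of_norm_lt_one (hz : ‖z‖ < 1) :
    jostVector a b n z 1 = jostPlus a b z n * z ^ (-n) := by
  simp only [jostVector, if_pos hz, Matrix.cons_val_one, Matrix.cons_val_fin_one]

lemma tendsto_zpow_nhdsInside (hz0 : z₁ ≠ 0) (n : ℤ) :
    Tendsto (fun z => z ^ n) (nhdsInside z₁) (𝓝 (z₁ ^ n)) :=
  (continuousAt_zpow₀ z₁ n (Or.inl hz0)).tendsto.mono_left (nhdsInside_le_nhds z₁)

lemma JacobiSecondMoment.jostPlus_eq_zero_of_tendsto (h : JacobiSecondMoment a b)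
    (hz : ‖z₁‖ ≤ 1) (hm : Tendsto (fun z => jostVector a b n z 1) (nhdsInside z₁) (𝓝 0)) :
    z₁ ≠ 0 ∧ jostPlus a b z₁ n = 0 := by
  have := nhdsInside_neBot hz
  obtain ⟨f, hf⟩ := exists_isJostFamily h
  have heq : (fun z => jostVector a b n z 1) =ᶠ[nhdsInside z₁] f n := by
    filter_upwards [eventually_nhdsInside z₁, eventually_ne_zero_nhdsInside z₁] with z hz' hz'0
    rw [jostVector_one_of_norm_lt_one hz'.1, hf.jostPlus_eq h hz'0 hz'.1.le, mul_right_comm,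
      zpow_neg, mul_inv_cancel₀ (zpow_ne_zero n hz'0), one_mul]
  have hlim : Tendsto (f n) (nhdsInside z₁) (𝓝 (f n z₁)) :=
    ((hf.continuousOn n).continuousWithinAt (mem_closedBall_zero_iff.2 hz)).mono_left
      ((nhdsInside_le_nhdsWithin_disc z₁).trans (nhdsWithin_mono _ Set.sdiff_subset))
  have hf0 : f n z₁ = 0 := tendsto_nhds_unique hlim (hm.congr' heq)
  have hz0 : z₁ ≠ 0 := by
    rintro rfl
    exact hf.apply_zero_ne_zero n hf0
  exact ⟨hz0, by rw [hf.jostPlus_eq h hz0 hz, hf0, mul_zero]⟩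

lemma JacobiSecondMoment.simpleZeroAlong_jostVector_one (h : JacobiSecondMoment a b)
    (hz0 : z₁ ≠ 0) (hz : ‖z₁‖ ≤ 1) (hn : jostPlus a b z₁ n = 0) :
    SimpleZeroAlong (fun z => jostVector a b n z 1) z₁ (nhdsInside z₁) := by
  obtain ⟨r, hr, hlim⟩ := h.exists_tendsto_jostPlus_div hz0 hz hn
  have hk : (a n : ℂ) * jostPlus a b z₁ (n + 1) ≠ 0 :=
    mul_ne_zero (Complex.ofReal_ne_zero.2 (h.ne_zero n))
      ((h.isJostPlus_jostPlus hz0 hz).succ_ne_zero h.ne_zero hn)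
  refine ⟨r / (a n * jostPlus a b z₁ (n + 1)) * z₁ ^ (-n),
    mul_ne_zero (div_ne_zero (Complex.ofReal_ne_zero.2 hr.ne) hk) (zpow_ne_zero _ hz0),
    ((hlim.div_const _).mul (tendsto_zpow_nhdsInside hz0 (-n))).congr' ?_⟩
  filter_upwards [eventually_nhdsInside z₁] with z hz'
  rw [jostVector_one_of_norm_lt_one hz'.1, mul_div_cancel_left₀ _ hk, div_mul_eq_mul_div]

lemma tendsto_inv_sub_self_div (hz0 : z₁ ≠ 0) (hsq : z₁⁻¹ = z₁) :
    Tendsto (fun z => (z⁻¹ - z) / (z - z₁)) (nhdsInside z₁) (𝓝 (-2)) := by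
  have hinv : Tendsto (fun z => z⁻¹) (nhdsInside z₁) (𝓝 z₁⁻¹) :=
    (continuousAt_inv₀ hz0).tendsto.mono_left (nhdsInside_le_nhds z₁)
  have hlim := (hinv.mul_const z₁).neg.sub_const 1
  rw [inv_mul_cancel₀ hz0, show (-1 - 1 : ℂ) = -2 by norm_num] at hlim
  refine hlim.congr' ?_
  filter_upwards [eventually_nhdsInside z₁, eventually_ne_zero_nhdsInside z₁] with z hz' hz'0
  rw [eq_div_iff (sub_ne_zero.2 hz'.2)]
  field_simp
  have hmul : z₁ * z₁ = 1 := by rw [← mul_inv_cancel₀ hz0, hsq]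
  linear_combination hmul

lemma JacobiSecondMoment.simpleZeroAlong_jostVector_zero (h : JacobiSecondMoment a b)
    (hz0 : z₁ ≠ 0) (hz : ‖z₁‖ ≤ 1) (hn : jostPlus a b z₁ n = 0)
    (hm : Tendsto (fun z => jostVector a b n z 0) (nhdsInside z₁) (𝓝 0)) :
    z₁⁻¹ = z₁ ∧ SimpleZeroAlong (fun z => jostVector a b n z 0) z₁ (nhdsInside z₁) := by
  have := nhdsInside_neBot hz
  obtain ⟨c, hc, hquot⟩ := h.exists_tendsto_jostMinus_div_jostWronskian hz0 hz hn
  have heq := (eventually_nhdsInside z₁).mono fun z hz' =>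
    jostVector_zero_of_norm_lt_one (a := a) (b := b) (n := n) hz'.1
  have hzn := zpow_ne_zero n hz0
  have hpow := tendsto_zpow_nhdsInside hz0 n
  have hinv : z₁⁻¹ = z₁ := by
    have hfactor : Tendsto (fun z : ℂ => z⁻¹ - z) (nhdsInside z₁) (𝓝 (z₁⁻¹ - z₁)) :=
      ((continuousAt_inv₀ hz0).sub continuousAt_id).tendsto.mono_left (nhdsInside_le_nhds z₁)
    have hzero := tendsto_nhds_unique (hm.congr' heq)
      (hquot.mul ((hfactor.div_const 2).mul hpow))
    simpa [hc, hzn, sub_eq_zero] using hzero.symm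
  refine ⟨hinv, _, ?_, (hquot.mul (((tendsto_inv_sub_self_div hz0 hinv).div_const 2).mul
    hpow)).congr' ?_⟩
  · simp [hc, hzn]
  · filter_upwards [heq] with z hz'
    rw [hz']
    ring

lemma JacobiSecondMoment.simpleZeroAlong_jostVector_inside (h : JacobiSecondMoment a b)
    (hz : ‖z₁‖ ≤ 1) (hm : Tendsto (jostVector a b n) (nhdsInside z₁) (𝓝 0)) :
    z₁ ≠ 0 ∧ z₁⁻¹ = z₁ ∧
      ∀ j, SimpleZeroAlong (fun z => jostVector a b n z j) z₁ (nhdsInside z₁) := by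
  have hm' := tendsto_pi_nhds.1 hm
  obtain ⟨hz0, hn⟩ := h.jostPlus_eq_zero_of_tendsto hz (hm' 1)
  obtain ⟨hinv, hleft⟩ := h.simpleZeroAlong_jostVector_zero hz0 hz hn (hm' 0)
  exact ⟨hz0, hinv, Fin.forall_fin_two.2 ⟨hleft, h.simpleZeroAlong_jostVector_one hz0 hz hn⟩⟩

end JostVector

section Inversion

variable {a b : ℤ → ℝ} {z z₁ : ℂ} {n : ℤ}

lemma jostVector_inv (hz0 : z ≠ 0) (hz : ‖z‖ < 1) (j : Fin 2) :
    jostVector a b n z⁻¹ j = jostVector a b n z j.rev := by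
  have hlt : ¬‖z⁻¹‖ < 1 := by
    rw [norm_inv, not_lt]
    exact (one_le_inv₀ (norm_pos_iff.2 hz0)).2 hz.le
  rw [jostVector, if_neg hlt, jostVector, if_pos hz]
  fin_cases j <;> simp [Fin.rev]

lemma eventually_nhdsOutside (z₁ : ℂ) : ∀ᶠ z in nhdsOutside z₁, 1 < ‖z‖ ∧ z ≠ z₁ :=
  self_mem_nhdsWithin

lemma tendsto_inv_nhdsInside (hz0 : z₁ ≠ 0) :
    Tendsto (fun z => z⁻¹) (nhdsInside z₁) (nhdsOutside z₁⁻¹) := by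
  refine tendsto_nhdsWithin_iff.2
    ⟨(continuousAt_inv₀ hz0).tendsto.mono_left (nhdsInside_le_nhds z₁), ?_⟩
  filter_upwards [eventually_nhdsInside z₁, eventually_ne_zero_nhdsInside z₁] with z hz' hz'0
  exact ⟨norm_inv z ▸ (one_lt_inv₀ (norm_pos_iff.2 hz'0)).2 hz'.1, inv_injective.ne hz'.2⟩

lemma tendsto_inv_nhdsOutside (hz0 : z₁ ≠ 0) :
    Tendsto (fun z => z⁻¹) (nhdsOutside z₁) (nhdsInside z₁⁻¹) := by
  refine tendsto_nhdsWithin_iff.2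
    ⟨(continuousAt_inv₀ hz0).tendsto.mono_left nhdsWithin_le_nhds, ?_⟩
  filter_upwards [eventually_nhdsOutside z₁] with z hz'
  exact ⟨norm_inv z ▸ inv_lt_one_of_one_lt₀ hz'.1, inv_injective.ne hz'.2⟩

lemma SimpleZeroAlong.comp_inv {g : ℂ → ℂ} (hz0 : z₁ ≠ 0)
    (hg : SimpleZeroAlong g z₁⁻¹ (nhdsInside z₁⁻¹)) :
    SimpleZeroAlong (fun z => g z⁻¹) z₁ (nhdsOutside z₁) := by
  obtain ⟨c, hc, hlim⟩ := hg
  have hinv : Tendsto (fun z => z⁻¹) (nhdsOutside z₁) (𝓝 z₁⁻¹) :=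
    (continuousAt_inv₀ hz0).tendsto.mono_left nhdsWithin_le_nhds
  refine ⟨c * (-z₁⁻¹ * z₁⁻¹), by simp [hc, hz0],
    ((hlim.comp (tendsto_inv_nhdsOutside hz0)).mul (hinv.const_mul (-z₁⁻¹))).congr' ?_⟩
  filter_upwards [eventually_nhdsOutside z₁] with z hz'
  have hz'0 : z ≠ 0 := norm_pos_iff.1 (one_pos.trans hz'.1)
  have hsub : z₁ - z ≠ 0 := sub_ne_zero.2 hz'.2.symm
  rw [Function.comp_apply, inv_sub_inv hz'0 hz0, ← neg_sub z₁ z]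
  field_simp

lemma SimpleZeroAlong.jostVector_outside {j : Fin 2} (hz0 : z₁ ≠ 0) (hg : SimpleZeroAlong
      (fun z => jostVector a b n z j.rev) z₁⁻¹ (nhdsInside z₁⁻¹)) :
    SimpleZeroAlong (fun z => jostVector a b n z j) z₁ (nhdsOutside z₁) := by
  obtain ⟨c, hc, hlim⟩ := hg.comp_inv hz0
  refine ⟨c, hc, hlim.congr' ?_⟩
  filter_upwards [eventually_nhdsOutside z₁] with z hz'
  have hz'0 : z ≠ 0 := norm_pos_iff.1 (one_pos.trans hz'.1)
  rw [← jostVector_inv (inv_ne_zero hz'0) (norm_inv z ▸ inv_lt_one_of_one_lt₀ hz'.1), inv_inv]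

lemma tendsto_jostVector_nhdsInside_inv (hz0 : z₁ ≠ 0)
    (hm : Tendsto (jostVector a b n) (nhdsOutside z₁) (𝓝 0)) :
    Tendsto (jostVector a b n) (nhdsInside z₁⁻¹) (𝓝 0) := by
  have hcomp := hm.comp (inv_inv z₁ ▸ tendsto_inv_nhdsInside (inv_ne_zero hz0))
  refine tendsto_pi_nhds.2 fun j => (tendsto_pi_nhds.1 hcomp j.rev).congr' ?_
  filter_upwards [eventually_nhdsInside z₁⁻¹, eventually_ne_zero_nhdsInside z₁⁻¹] with z hz' hz'0
  rw [Function.comp_apply, jostVector_inv hz'0 hz'.1, Fin.rev_rev]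

lemma VanishesAt.exists_inside (hm : VanishesAt (jostVector a b n) z₁) :
    ∃ w, (w = z₁ ∨ w = z₁⁻¹) ∧ ‖w‖ ≤ 1 ∧ Tendsto (jostVector a b n) (nhdsInside w) (𝓝 0) := by
  rcases hm with ⟨hz, hm⟩ | ⟨hz, hm⟩
  · exact ⟨z₁, Or.inl rfl, hz, hm⟩
  · exact ⟨z₁⁻¹, Or.inr rfl, norm_inv z₁ ▸ inv_le_one_of_one_le₀ hz,
      tendsto_jostVector_nhdsInside_inv (norm_pos_iff.1 (one_pos.trans_le hz)) hm⟩

end Inversion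

theorem lemma2p6_general (a b : ℤ → ℝ) (h : JacobiSecondMoment a b) (n : ℤ) (z₁ : ℂ)
    (hm : VanishesAt (jostVector a b n) z₁) :
    (z₁ = 1 ∨ z₁ = -1) ∧ ∀ j : Fin 2,
      SimpleZeroAlong (fun z => jostVector a b n z j) z₁ (nhdsInside z₁) ∧
        SimpleZeroAlong (fun z => jostVector a b n z j) z₁ (nhdsOutside z₁) := by
  obtain ⟨w, hw, hw1, hlim⟩ := hm.exists_inside
  obtain ⟨hw0, hinv, hinside⟩ := h.simpleZeroAlong_jostVector_inside hw1 hlim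
  obtain rfl : w = z₁ := hw.elim id fun hw' => by rw [← hinv, hw', inv_inv]
  refine ⟨mul_self_eq_one_iff.1 ?_, fun j => ⟨hinside j, .jostVector_outside hw0 ?_⟩⟩
  · exact (congrArg (w * ·) hinv).symm.trans (mul_inv_cancel₀ hw0)
  · rw [hinv]
    exact hinside j.rev

theorem lemma2p6 (a b : ℤ → ℝ → ℝ) (t : ℝ)
    (h : JacobiDecay (fun k => a k t) (fun k => b k t)) (n : ℤ) (z₁ : ℂ)
    (hm : VanishesAt (jostVector (fun k => a k t) (fun k => b k t) n) z₁) :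
    (z₁ = 1 ∨ z₁ = -1) ∧
      ∃ j : Fin 2,
        SimpleZeroAlong (fun z => jostVector (fun k => a k t) (fun k => b k t) n z j) z₁
            (nhdsInside z₁) ∧
          SimpleZeroAlong (fun z => jostVector (fun k => a k t) (fun k => b k t) n z j) z₁
            (nhdsOutside z₁) :=
  let ⟨hz, hzero⟩ := lemma2p6_general _ _ h.jacobiSecondMoment n z₁ hm
  ⟨hz, 0, hzero 0⟩
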